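/- A game arena $\mathcal G=(P,V,(V_p)_{p\in P},v_0,E)$ consists of a finite set $P$ of players, a finite set $V$ of vertices partitioned into sets $V_p$ ($p\in P$), an initial vertex $v_0\in V$, and edges $E\subseteq V\times V$ such that every vertex reachable from $v_0$ has an outgoing edge. A play is an infinite path from $v_0$; a history is a nonempty finite prefix of a play. A strategy $\sigma_p$ of $p$ maps each history $hv$ with $v\in V_p$ to a successor of $v$; a strategy profile $\sigma=(\sigma_p)_{p\in P}$ determines the play $\mathrm{out}(\sigma)$, and $\sigma[p\mapsto\sigma'_p]$ is $\sigma$ with $p$'s strategy replaced by $\sigma'_p$. For a set $\mathcal F$ of subsets of $V$, $\mathrm{Muller}(\mathcal F)$ is the set of plays whose set $\mathrm{Inf}(\rho)$ of vertices visited infinitely often belongs to $\mathcal F$; let $\Omega$ be the set of all these objectives. $\mathrm{Winnable}^p$ is the set of those sets of plays $O$ for which $p$ has a strategy all of whose consistent plays lie in $O$. Each player $p$ has an objective $O_p=\mathrm{Muller}(\mathcal F_p)$, and wins under $\sigma$ if $\mathrm{out}(\sigma)\in O_p$. For an adversary of knowledge type $knw\in\{\mathsf{pw},\mathsf{gw},\mathsf{pg},\mathsf{pgw}\}$,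 the set $\mathrm{Obj}^{p}_{knw}(\sigma)$ of objectives of $p$ that he considers possible is: - $\mathsf{pw}$: all $O\in\Omega'$ such that ($\mathrm{out}(\sigma)\in O$ and $p$ wins) or ($\mathrm{out}(\sigma)\notin O$ and $p$ loses); - $\mathsf{gw}$: all $O\in\Omega$ such that ($p$ wins and $O\ne\varnothing$) or ($p$ loses and $O\notin\mathrm{Winnable}^p$); - $\mathsf{pg}$: all $O\in\Omega$ such that $\mathrm{out}(\sigma)\in O$ or $O\notin\mathrm{Winnable}^p$; - $\mathsf{pgw}$: all $O\in\Omega$ such that ($\mathrm{out}(\sigma)\in O$ and $p$ wins) or ($\mathrm{out}(\sigma)\notin O$, $p$ loses and $O\notin\mathrm{Winnable}^p$). Here, in the case $\mathsf{pw}$, where the adversary does not know $E$, $\Omega'$ is either (a) the set of all $O\subseteq V^\omega$, or (b) the set of all $\{\rho\in V^\omega\mid \mathrm{Inf}(\rho)\in\mathcal F\}$ with $\mathcal F\subseteq 2^V$. A profile $\sigma$ is an objective-indistinguishability equilibrium (OIE) for $knw$ if $\mathrm{Obj}^{p}_{knw}(\sigma[p\mapsto\sigma'_p])\subseteq\mathrm{Obj}^{p}_{knw}(\sigma)$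 for every player $p$ and every strategy $\sigma'_p$ of $p$. **Theorem.** For each $knw\in\{\mathsf{pw},\mathsf{gw},\mathsf{pg},\mathsf{pgw}\}$ and each of the choices (a), (b) of $\Omega'$, the following problem is decidable: given a game arena $\mathcal G$ and, for each player $p$, a set $\mathcal F_p\subseteq 2^V$ (all listed explicitly), does there exist an OIE for $knw$ in $\mathcal G$ with the objectives $O_p=\mathrm{Muller}(\mathcal F_p)$? -/

import Mathlib

/-- A finite multiplayer turn-based game arena with player set `P` and vertex set `V` (both are
instantiated with finite types). The partition `(V_p)` of `V` is given by `owner`: `V_p` is the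
set of vertices `v` with `owner v = p`. No vertex reachable from the initial vertex is a dead end;
this is exactly what makes the outcome of every strategy profile an infinite play. -/
structure Arena (P V : Type) where
  owner : V → P
  init : V
  edge : V → V → Prop
  exists_succ : ∀ v, Relation.ReflTransGen edge init v → ∃ w, edge v w

/-- The vertices that occur infinitely often in an infinite word. -/
def infSet {V : Type} (ρ : ℕ → V) : Set V :=
  {v | ∀ i, ∃ j, i ≤ j ∧ ρ j = v}

/-- The set of infinite words over `V` selected by a Muller condition `F`. -/
def mullerWords {V : Type} (F : Set (Set V)) : Set (ℕ → V) :=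
  {ρ | infSet ρ ∈ F}

/-- The type of information available to the adversary:
`p` = the play, `g` = the game arena, `w` = the set of winners. -/
inductive Knowledge where
  | pw
  | gw
  | pg
  | pgw

namespace Arena

variable {P V : Type} (G : Arena P V)

/-- The set of plays. -/
def Play : Set (ℕ → V) :=
  {ρ | ρ 0 = G.init ∧ ∀ i, G.edge (ρ i) (ρ (i + 1))}

/-- `IsHist h v`: the word `h v` is a history, i.e. a nonempty finite prefix of a play. -/
def IsHist (h : List V) (v : V) : Prop :=
  ∃ ρ ∈ G.Play, ∃ n, h = (List.range n).map ρ ∧ v = ρ n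

variable {G}

theorem isHist_of_play {ρ : ℕ → V} (hρ : ρ ∈ G.Play) (n : ℕ) :
    G.IsHist ((List.range n).map ρ) (ρ n) :=
  ⟨ρ, hρ, n, rfl, rfl⟩

theorem reachable_of_play {ρ : ℕ → V} (hρ : ρ ∈ G.Play) (n : ℕ) :
    Relation.ReflTransGen G.edge G.init (ρ n) := by
  induction n with
  | zero => rw [hρ.1]
  | succ n ih => exact ih.tail (hρ.2 n)

/-- From a reachable vertex there is an infinite path. -/
theorem exists_path (v : V) (hv : Relation.ReflTransGen G.edge G.init v) :
    ∃ π : ℕ → V, π 0 = v ∧ ∀ i, G.edge (π i) (π (i + 1)) := by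
  let R := {u : V // Relation.ReflTransGen G.edge G.init u}
  have hs : ∀ u : R, ∃ w : R, G.edge u.1 w.1 := fun u => by
    obtain ⟨w, hw⟩ := G.exists_succ u.1 u.2
    exact ⟨⟨w, u.2.tail hw⟩, hw⟩
  choose s hs using hs
  refine ⟨fun i => (s^[i] ⟨v, hv⟩).1, rfl, fun i => ?_⟩
  simp only [Function.iterate_succ_apply']
  exact hs _

variable (G) in
theorem isHist_init : G.IsHist [] G.init := by
  obtain ⟨π, h0, hπ⟩ := exists_path (G := G) G.init .refl
  exact ⟨π, ⟨h0, hπ⟩, 0, rfl, h0.symm⟩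

theorem IsHist.snoc {h : List V} {v w : V} (hh : G.IsHist h v) (hw : G.edge v w) :
    G.IsHist (h ++ [v]) w := by
  obtain ⟨ρ, hρ, n, rfl, rfl⟩ := hh
  obtain ⟨π, h0, hπ⟩ := exists_path w ((reachable_of_play hρ n).tail hw)
  have hle : ∀ i, i ≤ n → (fun i => if i ≤ n then ρ i else π (i - (n + 1))) i = ρ i :=
    fun i hi => if_pos hi
  refine ⟨fun i => if i ≤ n then ρ i else π (i - (n + 1)), ⟨?_, fun i => ?_⟩, n + 1, ?_, ?_⟩
  · simpa using hρ.1
  · rcases lt_trichotomy i n with h | h | h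
    · simpa [h.le, Nat.succ_le_of_lt h] using hρ.2 i
    · subst h
      simpa [h0] using hw
    · have e : i + 1 - (n + 1) = (i - (n + 1)) + 1 := by omega
      have h1 : ¬ i ≤ n := by omega
      have h2 : ¬ i + 1 ≤ n := by omega
      simp only [if_neg h1, if_neg h2, e]
      exact hπ _
  · rw [List.range_succ, List.map_append]
    congr 1
    · refine List.map_congr_left fun i hi => ?_
      exact (hle i (List.mem_range.1 hi).le).symm
    · simp
  · simp [h0]

variable (G)

/-- A strategy of player `p`: a function on the histories `h v` that end in a vertex `v` of `p`,
choosing a successor of `v`. -/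
structure Strategy (p : P) where
  next : ∀ (h : List V) (v : V), G.IsHist h v → G.owner v = p → V
  legal : ∀ h v hh hp, G.edge v (next h v hh hp)

/-- A strategy profile. -/
abbrev Profile : Type := ∀ p, G.Strategy p

/-- The history `h v` of length `n + 1` produced by a strategy profile. -/
def run (σ : G.Profile) : ℕ → {x : List V × V // G.IsHist x.1 x.2}
  | 0 => ⟨([], G.init), G.isHist_init⟩
  | n + 1 =>
    let x := run σ n
    ⟨(x.1.1 ++ [x.1.2], (σ (G.owner x.1.2)).next x.1.1 x.1.2 x.2 rfl),
      x.2.snoc ((σ (G.owner x.1.2)).legal x.1.1 x.1.2 x.2 rfl)⟩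

/-- The outcome of a strategy profile. -/
def out (σ : G.Profile) : ℕ → V := fun n => (G.run σ n).1.2

/-- The plays consistent with a strategy of player `p`. -/
def outOf {p : P} (τ : G.Strategy p) : Set (ℕ → V) :=
  {ρ | ∃ hρ : ρ ∈ G.Play, ∀ i (hp : G.owner (ρ i) = p),
    ρ (i + 1) = τ.next ((List.range i).map ρ) (ρ i) (isHist_of_play hρ i) hp}

/-- The objectives for which player `p` has a winning strategy. -/
def Winnable (p : P) : Set (Set (ℕ → V)) :=
  {O | ∃ τ : G.Strategy p, G.outOf τ ⊆ O}

/-- The set of winners. -/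
def Win (σ : G.Profile) (α : P → Set (ℕ → V)) : Set P :=
  {p | G.out σ ∈ α p}

/-- The Muller objective given by `F`, a set of plays. -/
def muller (F : Set (Set V)) : Set (ℕ → V) :=
  {ρ | ρ ∈ G.Play ∧ infSet ρ ∈ F}

/-- The class `Ω` of all Muller objectives of the arena. -/
def mullerClass : Set (Set (ℕ → V)) := Set.range G.muller

/-- The objectives of player `p` that the adversary considers possible. An adversary who knows the
arena considers objectives (sets of plays) in `Ω`. An adversary of type `pw` does not know the
edges, hence considers sets of arbitrary infinite words over `V`, taken from the class `Ω'`. -/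
def Obj (Ω Ω' : Set (Set (ℕ → V))) (α : P → Set (ℕ → V)) (p : P) (σ : G.Profile) :
    Knowledge → Set (Set (ℕ → V))
  | .pw => {O | O ∈ Ω' ∧ ((G.out σ ∈ O ∧ p ∈ G.Win σ α) ∨ (G.out σ ∉ O ∧ p ∉ G.Win σ α))}
  | .gw => {O | O ∈ Ω ∧
      ((p ∈ G.Win σ α ∧ O ≠ ∅) ∨ (p ∉ G.Win σ α ∧ O ∉ G.Winnable p))}
  | .pg => {O | O ∈ Ω ∧ (G.out σ ∈ O ∨ (G.out σ ∉ O ∧ O ∉ G.Winnable p))}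
  | .pgw => {O | O ∈ Ω ∧
      ((G.out σ ∈ O ∧ p ∈ G.Win σ α) ∨
        (G.out σ ∉ O ∧ p ∉ G.Win σ α ∧ O ∉ G.Winnable p))}

open Classical in
/-- Objective-indistinguishability equilibrium: no player can enlarge her set of candidate
objectives by deviating alone. -/
def IsOIE (Ω Ω' : Set (Set (ℕ → V))) (knw : Knowledge) (α : P → Set (ℕ → V))
    (σ : G.Profile) : Prop :=
  ∀ (p : P) (τ : G.Strategy p),
    G.Obj Ω Ω' α p (Function.update σ p τ) knw ⊆ G.Obj Ω Ω' α p σ knw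

end Arena

/-- Finite descriptions of games: number of players, number of vertices, initial vertex, list of
the owners of the vertices, list of edges, and for each player a list of sets of vertices, each
given as a list of vertices. -/
abbrev GameCode : Type :=
  ℕ × ℕ × ℕ × List ℕ × List (ℕ × ℕ) × List (List (List ℕ))

/-- `Encodes c G F`: the code `c` describes the arena `G` with players `0, …, m - 1` and vertices
`0, …, n - 1`, and the Muller condition `F p` of each player `p`. -/
def Encodes {m n : ℕ} :
    GameCode → Arena (Fin m) (Fin n) → (Fin m → Set (Set (Fin n))) → Prop
  | (m', n', i, own, es, fs), G, F =>
    m' = m ∧ n' = n ∧ i = (G.init : ℕ) ∧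
    own = List.ofFn (fun v => (G.owner v : ℕ)) ∧
    (∀ a b : ℕ, (a, b) ∈ es ↔ ∃ u v : Fin n, (u : ℕ) = a ∧ (v : ℕ) = b ∧ G.edge u v) ∧
    fs.length = m ∧
    ∀ (p : Fin m) (S : Set (Fin n)),
      S ∈ F p ↔ ∃ l ∈ fs.getD p [], S = {v : Fin n | (v : ℕ) ∈ l}

/-- Every arena with Muller conditions has a code. -/
theorem exists_encodes {m n : ℕ} (G : Arena (Fin m) (Fin n)) (F : Fin m → Set (Set (Fin n))) :
    ∃ c, Encodes c G F := by
  classical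
  let lst : Set (Fin n) → List ℕ := fun S => S.toFinset.toList.map Fin.val
  have hl : ∀ S : Set (Fin n), S = {v : Fin n | (v : ℕ) ∈ lst S} := fun S => by
    ext v
    simp [lst, Fin.val_inj]
  refine ⟨(m, n, G.init, List.ofFn (fun v => (G.owner v : ℕ)),
    (Finset.univ.filter fun x : Fin n × Fin n => G.edge x.1 x.2).toList.map
      (fun x => ((x.1 : ℕ), (x.2 : ℕ))),
    List.ofFn fun p => (F p).toFinset.toList.map lst), rfl, rfl, rfl, rfl, ?_, ?_, ?_⟩
  · intro a b
    simp only [List.mem_map, Finset.mem_toList, Finset.mem_filter, Finset.mem_univ, true_and,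
      Prod.exists, Prod.mk.injEq]
    exact ⟨fun ⟨u, v, h, h1, h2⟩ => ⟨u, v, h1, h2, h⟩, fun ⟨u, v, h1, h2, h⟩ => ⟨u, v, h, h1, h2⟩⟩
  · simp
  · intro p S
    have e : (List.ofFn fun p => (F p).toFinset.toList.map lst).getD p []
        = (F p).toFinset.toList.map lst := by
      simp [List.getD_eq_getElem?_getD]
    rw [e]
    simp only [List.mem_map, Finset.mem_toList, Set.mem_toFinset]
    constructor
    · exact fun h => ⟨_, ⟨S, h, rfl⟩, hl S⟩
    · rintro ⟨_, ⟨T, hT, rfl⟩, h⟩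
      rw [h, ← hl T]
      exact hT

/-!
The set `Obj` of candidate objectives of a player depends, in all cases but one, only on the set of
vertices that the outcome visits infinitely often. If this set is `S` for the profile and `T` after
a deviation, then the required inclusion holds if and only if `T` lies in a family `tolerated` that
is defined from `S`, the player's own condition, and the winnability for him of `{S}` and `{S}ᶜ`
(`Arena.obj_subset_iff`). Hence an equilibrium is a profile such that every player, after every move
by which he can leave its outcome, faces a coalition of the others that wins the Muller game for his
tolerated family (`Arena.exists_profile_iff_hasCertificate`). The exception is the adversary who
sees the play and the winners and admits arbitrary sets of words: then no player may be able to
change the outcome at all, and the arena has only one play (`Arena.exists_isOIE_pw_univ_iff`).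

What remains is to decide which player wins a finite Muller game. Winning regions are certified by
the rules of the McNaughton–Zielonka recursion, where `X` and `v` range over subsets and vertices of
a subarena `U`: a player wins on all of `U` if `U` itself satisfies his condition and, for every
`v`, he wins on the complement of his attractor of `v`; he also wins on `U` if he wins on a trap `X`
for his opponent and on the complement of his attractor of `X`. The rules are sound: a winning
strategy is built, as a nondeterministic machine with memory, along a derivation
(`WinsAll.exists_machine`). They are complete, because induction on `U` splits it into a derivable
trap for each of the two players (`exists_isPartition`). Since the opponent's certificate yields a
counterplay against every strategy (`Arena.exists_play_of_machine`), certificates characterize both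
the winnable objectives and the power of coalitions.

Attractors are complements of largest traps, and derivability is membership in all families closed
under the rules. So the whole condition is a formula whose quantifiers range over vertices, sets of
vertices, and families of such sets. With binary expansions as codes for finite sets, they become
bounded quantifiers over natural numbers, and the condition is primitive recursive.
-/

/-! ### Muller games of two players -/

section TwoPlayer

variable {V : Type}

/-- `IsTrap E A U B`: in the game restricted to `U`, the player who controls `A` has no move that
leaves `B`, and his opponent always has a move that stays in `B`. The existence of a successor in
`B` is required at all vertices, so that `B` is a subarena. -/
def IsTrap (E : V → V → Prop) (A U B : Set V) : Prop :=
  ∀ v ∈ B, v ∈ U ∧ (v ∈ A → ∀ w ∈ U, E v w → w ∈ B) ∧ ∃ w ∈ B, E v w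

/-- `IsMaxTrap E A U X Z`: `Z` is the largest trap for the player controlling `A` that avoids `X`.
Its complement in `U` is the attractor of `X` for that player. -/
def IsMaxTrap (E : V → V → Prop) (A U X Z : Set V) : Prop :=
  IsTrap E A U Z ∧ (∀ v ∈ Z, v ∉ X) ∧
    ∀ B, IsTrap E A U B → (∀ v ∈ B, v ∉ X) → ∀ v ∈ B, v ∈ Z

/-- A subarena: every vertex of `U` has a successor in `U`. -/
def IsSubarena (E : V → V → Prop) (U : Set V) : Prop :=
  ∀ v ∈ U, ∃ w ∈ U, E v w

/-- Closure of a family `C` of sets of vertices under the two rules of the McNaughton–Zielonka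
recursion, for the player who controls `A` and wants the set of vertices seen infinitely often to
lie in `T`: he wins on `U` if `U ∈ T` and he wins outside his attractor of each vertex, or if he
wins on a trap for the opponent and outside his attractor of that trap. -/
def RuleClosed (E : V → V → Prop) (A : Set V) (T C : Set (Set V)) : Prop :=
  ∅ ∈ C ∧
  (∀ U, IsSubarena E U → U ∈ T → (∀ v ∈ U, ∃ Z, Z ∈ C ∧ IsMaxTrap E A U {v} Z) → U ∈ C) ∧
  (∀ U X Z, IsSubarena E U → X ∈ C → Z ∈ C → IsTrap E Aᶜ U X → IsMaxTrap E A U X Z → U ∈ C)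

/-- `WinsAll E A T U`: derivability, by the rules of `RuleClosed`, of the fact that the player who
controls `A` wins from every vertex of `U` in the game restricted to `U`. The least family closed
under the rules is written as an intersection, which keeps the definition a formula with
quantifiers over finite sets only. -/
def WinsAll (E : V → V → Prop) (A : Set V) (T : Set (Set V)) (U : Set V) : Prop :=
  ∀ C, RuleClosed E A T C → U ∈ C

variable {E : V → V → Prop} {A U X Z : Set V} {T : Set (Set V)}

theorem WinsAll.empty : WinsAll E A T ∅ := fun _ hC => hC.1

theorem WinsAll.of_mem (hU : IsSubarena E U) (hT : U ∈ T)
    (h : ∀ v ∈ U, ∃ Z, WinsAll E A T Z ∧ IsMaxTrap E A U {v} Z) : WinsAll E A T U :=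
  fun C hC => hC.2.1 U hU hT fun v hv =>
    let ⟨Z, hZ, hm⟩ := h v hv
    ⟨Z, hZ C hC, hm⟩

theorem WinsAll.of_trap (hU : IsSubarena E U) (hX : WinsAll E A T X) (hZ : WinsAll E A T Z)
    (ht : IsTrap E Aᶜ U X) (hm : IsMaxTrap E A U X Z) : WinsAll E A T U :=
  fun C hC => hC.2.2 U X Z hU (hX C hC) (hZ C hC) ht hm

theorem IsTrap.subset {B : Set V} (h : IsTrap E A U B) : B ⊆ U := fun v hv => (h v hv).1

theorem IsTrap.isSubarena {B : Set V} (h : IsTrap E A U B) : IsSubarena E B :=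
  fun v hv => (h v hv).2.2

theorem IsTrap.trans {B C : Set V} (h : IsTrap E A U B) (h' : IsTrap E A B C) : IsTrap E A U C :=
  fun v hv => ⟨h.subset (h'.subset hv),
    fun hA w hw he => (h' v hv).2.1 hA w ((h v (h'.subset hv)).2.1 hA w hw he) he, (h' v hv).2.2⟩

theorem IsTrap.empty : IsTrap E A U ∅ := fun _ hv => hv.elim

theorem exists_isMaxTrap (E : V → V → Prop) (A U X : Set V) : ∃ Z, IsMaxTrap E A U X Z := by
  refine ⟨{v | ∃ B, IsTrap E A U B ∧ (∀ v ∈ B, v ∉ X) ∧ v ∈ B}, ?_, ?_, ?_⟩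
  · rintro v ⟨B, hB, hX, hv⟩
    refine ⟨hB.subset hv, fun hA w hw he => ⟨B, hB, hX, (hB v hv).2.1 hA w hw he⟩, ?_⟩
    obtain ⟨w, hw, he⟩ := (hB v hv).2.2
    exact ⟨w, ⟨B, hB, hX, hw⟩, he⟩
  · rintro v ⟨B, hB, hX, hv⟩
    exact hX v hv
  · exact fun B hB hX v hv => ⟨B, hB, hX, hv⟩

/-! ### Determinacy -/

/-- The winning regions: `X` for the player who controls `A`, `U \ X` for his opponent. -/
def IsPartition (E : V → V → Prop) (A : Set V) (T : Set (Set V)) (U X : Set V) : Prop :=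
  IsTrap E Aᶜ U X ∧ WinsAll E A T X ∧ IsTrap E A U (U \ X) ∧ WinsAll E Aᶜ Tᶜ (U \ X)

theorem IsPartition.compl (h : IsPartition E A T U X) : IsPartition E Aᶜ Tᶜ U (U \ X) := by
  have e : U \ (U \ X) = X := Set.sdiff_sdiff_cancel_left h.1.subset
  refine ⟨?_, h.2.2.2, ?_, ?_⟩
  · rw [compl_compl]; exact h.2.2.1
  · rw [e]; exact h.1
  · rw [e, compl_compl, compl_compl]; exact h.2.1

/-- If the opponent of the player whom the full set `U` favours wins somewhere after the attractor
of some vertex is removed, then his winning region is extended by its attractor, and the remaining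
vertices form a smaller game. -/
theorem exists_isPartition_of_trap (hU : IsSubarena E U) (hX : WinsAll E A T X)
    (hne : X.Nonempty) (ht : IsTrap E Aᶜ U X)
    (ih : ∀ W, W ⊂ U → IsSubarena E W → ∃ Y, IsPartition E A T W Y) :
    ∃ Y, IsPartition E A T U Y := by
  obtain ⟨Z, hZ⟩ := exists_isMaxTrap E A U X
  have hZU : Z ⊂ U := by
    refine ⟨hZ.1.subset, fun h => ?_⟩
    obtain ⟨x, hx⟩ := hne
    exact hZ.2.1 x (h (ht.subset hx)) hx
  obtain ⟨Y, hY1, hY2, hY3, hY4⟩ := ih Z hZU hZ.1.isSubarena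
  have e : U \ (U \ (Z \ Y)) = Z \ Y :=
    Set.sdiff_sdiff_cancel_left (Set.sdiff_subset.trans hZ.1.subset)
  -- the new region is `U' = U \ (Z \ Y)`, the union of the attractor of `X` and of `Y`
  have hXU' : ∀ v ∈ X, v ∈ U \ (Z \ Y) := fun v hv => ⟨ht.subset hv, fun h => hZ.2.1 v h.1 hv⟩
  have hO : IsTrap E A U (Z \ Y) := hZ.1.trans hY3
  have hYU' : ∀ v ∈ Y, v ∈ U \ (Z \ Y) := fun v hv => ⟨hZ.1.subset (hY1.subset hv), fun h => h.2 hv⟩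
  -- a set of vertices that avoids `X` and traps the player inside `U'` lies in `Z`
  have key : ∀ B, IsTrap E A (U \ (Z \ Y)) B → (∀ v ∈ B, v ∉ X) → ∀ v ∈ B, v ∈ Z := by
    intro B hB hBX v hv
    have hBO : IsTrap E A U (B ∪ (Z \ Y)) := by
      rintro v (hv | hv)
      · refine ⟨(hB.subset hv).1, fun hA w hw he => ?_, ?_⟩
        · by_cases hwO : w ∈ Z \ Y
          · exact .inr hwO
          · exact .inl ((hB v hv).2.1 hA w ⟨hw, hwO⟩ he)
        · obtain ⟨w, hw, he⟩ := (hB v hv).2.2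
          exact ⟨w, .inl hw, he⟩
      · refine ⟨hO.subset hv, fun hA w hw he => .inr ((hO v hv).2.1 hA w hw he), ?_⟩
        obtain ⟨w, hw, he⟩ := (hO v hv).2.2
        exact ⟨w, .inr hw, he⟩
    refine hZ.2.2 _ hBO ?_ v (.inl hv)
    rintro v (hv | hv)
    · exact hBX v hv
    · exact hZ.2.1 v hv.1
  have htr : IsTrap E Aᶜ U (U \ (Z \ Y)) := by
    intro v hv
    by_cases hvZ : v ∈ Z
    · have hvY : v ∈ Y := by_contra fun h => hv.2 ⟨hvZ, h⟩
      refine ⟨hv.1, fun hA w hw he => ⟨hw, fun hwO => ?_⟩, ?_⟩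
      · exact hwO.2 ((hY1 v hvY).2.1 hA w hwO.1 he)
      · obtain ⟨w, hw, he⟩ := (hY1 v hvY).2.2
        exact ⟨w, hYU' w hw, he⟩
    · by_cases hvX : v ∈ X
      · refine ⟨hv.1, fun hA w hw he => hXU' w ((ht v hvX).2.1 hA w hw he), ?_⟩
        obtain ⟨w, hw, he⟩ := (ht v hvX).2.2
        exact ⟨w, hXU' w hw, he⟩
      · -- otherwise `v` could be added to the largest trap `Z`
        have hins : ¬ IsTrap E A U (insert v Z) := fun h =>
          hvZ (hZ.2.2 _ h (by
            rintro w (rfl | hw)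
            · exact hvX
            · exact hZ.2.1 w hw) v (.inl rfl))
        have hZi : ∀ x ∈ Z, x ∈ U ∧ (x ∈ A → ∀ w ∈ U, E x w → w ∈ insert v Z) ∧
            ∃ w ∈ insert v Z, E x w := fun x hx =>
          ⟨hZ.1.subset hx, fun hA w hw he => .inr ((hZ.1 x hx).2.1 hA w hw he),
            let ⟨w, hw, he⟩ := (hZ.1 x hx).2.2
            ⟨w, .inr hw, he⟩⟩
        refine ⟨hv.1, fun hA w hw he => ⟨hw, fun hwO => hins ?_⟩, ?_⟩
        · rintro x (rfl | hx)
          · exact ⟨hv.1, fun h => absurd h hA, w, .inr hwO.1, he⟩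
          · exact hZi x hx
        · by_contra hno
          push Not at hno
          refine hins ?_
          have hout : ∀ w ∈ U, E v w → w ∈ Z := fun w hw he => by
            by_contra h
            exact hno w ⟨hw, fun h' => h h'.1⟩ he
          rintro x (rfl | hx)
          · obtain ⟨w, hw, he⟩ := hU x hv.1
            exact ⟨hv.1, fun _ w hw he => .inr (hout w hw he), w, .inr (hout w hw he), he⟩
          · exact hZi x hx
  refine ⟨U \ (Z \ Y), htr, ?_, ?_, ?_⟩
  · refine WinsAll.of_trap htr.isSubarena hX hY2 (fun v hv => ?_)
      ⟨fun v hv => ?_, fun v hv => ?_, ?_⟩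
    · exact ⟨hXU' v hv, fun hA w hw he => (ht v hv).2.1 hA w hw.1 he, (ht v hv).2.2⟩
    · refine ⟨hYU' v hv, fun hA w hw he => ?_, (hY1 v hv).2.2⟩
      have hwZ := (hZ.1 v (hY1.subset hv)).2.1 hA w hw.1 he
      exact by_contra fun h => hw.2 ⟨hwZ, h⟩
    · exact hZ.2.1 v (hY1.subset hv)
    · intro B hB hBX v hv
      have hvZ := key B hB hBX v hv
      exact by_contra fun h => (hB.subset hv).2 ⟨hvZ, h⟩
  · rw [e]; exact hO
  · rw [e]; exact hY4

theorem exists_isPartition_of_mem (hU : IsSubarena E U) (hT : U ∈ T)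
    (ih : ∀ W, W ⊂ U → IsSubarena E W → ∃ Y, IsPartition E A T W Y) :
    ∃ Y, IsPartition E A T U Y := by
  by_cases h : ∀ v ∈ U, ∃ Z, WinsAll E A T Z ∧ IsMaxTrap E A U {v} Z
  · refine ⟨U, fun v hv => ⟨hv, fun _ w hw _ => hw, hU v hv⟩, .of_mem hU hT h, ?_, ?_⟩
    · rw [Set.sdiff_self]; exact .empty
    · rw [Set.sdiff_self]; exact .empty
  push Not at h
  obtain ⟨v, hv, h⟩ := h
  obtain ⟨Z, hZ⟩ := exists_isMaxTrap E A U {v}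
  have hZU : Z ⊂ U := ⟨hZ.1.subset, fun h => hZ.2.1 v (h hv) rfl⟩
  obtain ⟨Y, hY⟩ := ih Z hZU hZ.1.isSubarena
  have hne : (Z \ Y).Nonempty := by
    rw [Set.nonempty_iff_ne_empty]
    intro h0
    refine h Z ?_ hZ
    rw [Set.Subset.antisymm (Set.sdiff_eq_empty.1 h0) hY.1.subset]
    exact hY.2.1
  have ht : IsTrap E Aᶜᶜ U (Z \ Y) := by
    rw [compl_compl]; exact hZ.1.trans hY.2.2.1
  obtain ⟨W, hW⟩ := exists_isPartition_of_trap hU hY.2.2.2 hne ht fun W hW hs =>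
    let ⟨Y, hY⟩ := ih W hW hs
    ⟨_, hY.compl⟩
  have := hW.compl
  rw [compl_compl, compl_compl] at this
  exact ⟨_, this⟩

/-- **Determinacy** of Muller games on finite arenas, in certificate form. -/
theorem exists_isPartition [Finite V] (A : Set V) (T : Set (Set V)) (hU : IsSubarena E U) :
    ∃ X, IsPartition E A T U X := by
  induction U using WellFoundedLT.induction with
  | ind U ih =>
    by_cases hT : U ∈ T
    · exact exists_isPartition_of_mem hU hT fun W hW hs => ih W hW hs
    · obtain ⟨X, hX⟩ := exists_isPartition_of_mem (A := Aᶜ) (T := Tᶜ) hU hT fun W hW hs =>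
        let ⟨Y, hY⟩ := ih W hW hs
        ⟨_, hY.compl⟩
      have := hX.compl
      rw [compl_compl, compl_compl] at this
      exact ⟨_, this⟩

end TwoPlayer

/-! ### Winning strategies with memory -/

section Machines

variable {V : Type}

theorem infSet_shift (ρ : ℕ → V) (n : ℕ) : infSet (fun i => ρ (n + i)) = infSet ρ := by
  ext v
  constructor
  · intro h i
    obtain ⟨j, hj, e⟩ := h i
    exact ⟨n + j, by omega, e⟩
  · intro h i
    obtain ⟨j, hj, e⟩ := h (n + i)
    exact ⟨j - n, by omega, by rw [← e]; exact congrArg ρ (by omega)⟩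

/-- A nondeterministic strategy with memory, for the player who controls `A`, in the game
restricted to `U`. A state `q` contains the current vertex `pos q`. At vertices of `X` the strategy
may stop; elsewhere it has a step, and at vertices of the opponent it has a step for each of his
moves. All infinite runs, whatever the steps chosen, satisfy the Muller condition `T`. -/
structure Machine (E : V → V → Prop) (A U X : Set V) (T : Set (Set V)) where
  State : Type
  pos : State → V
  step : State → State → Prop
  pos_mem : ∀ q, pos q ∈ U
  exists_state : ∀ v ∈ U, ∃ q, pos q = v
  edge_of_step : ∀ q q', step q q' → E (pos q) (pos q')
  exists_step : ∀ q, pos q ∉ X → ∃ q', step q q'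
  exists_step_to : ∀ q w, pos q ∉ X → pos q ∉ A → w ∈ U → E (pos q) w →
    ∃ q', step q q' ∧ pos q' = w
  wins : ∀ s : ℕ → State, (∀ i, step (s i) (s (i + 1))) → infSet (fun i => pos (s i)) ∈ T

variable {E : V → V → Prop} {A U X Z : Set V} {T : Set (Set V)}

theorem Machine.wins_of_eventually (M : Machine E A U X T) (ρ : ℕ → V) (n : ℕ) (s : ℕ → M.State)
    (hs : ∀ i, M.step (s i) (s (i + 1))) (h : ∀ i, ρ (n + i) = M.pos (s i)) : infSet ρ ∈ T := by
  rw [← infSet_shift ρ n]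
  simp only [h]
  exact M.wins s hs

/-! ### Attractors -/

/-- The vertices from which the player who controls `A` can force a visit to `X` within `k` moves,
in the game restricted to `U`. -/
def attr (E : V → V → Prop) (A U X : Set V) : ℕ → Set V
  | 0 => U ∩ X
  | k + 1 => attr E A U X k ∪ {v | v ∈ U ∧
      ((v ∈ A ∧ ∃ w ∈ attr E A U X k, E v w) ∨
        (v ∉ A ∧ ∀ w ∈ U, E v w → w ∈ attr E A U X k))}

theorem attr_mono : Monotone (attr E A U X) :=
  monotone_nat_of_le_succ fun _ => Set.subset_union_left

theorem attr_subset (k : ℕ) : attr E A U X k ⊆ U := by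
  induction k with
  | zero => exact Set.inter_subset_left
  | succ k ih => exact Set.union_subset ih fun v hv => hv.1

theorem IsTrap.not_mem_attr {B : Set V} (hB : IsTrap E A U B) (hX : ∀ v ∈ B, v ∉ X) (k : ℕ) :
    ∀ v ∈ B, v ∉ attr E A U X k := by
  induction k with
  | zero => exact fun v hv h => hX v hv h.2
  | succ k ih =>
    rintro v hv (h | ⟨_, ⟨hA, w, hw, he⟩ | ⟨_, h⟩⟩)
    · exact ih v hv h
    · exact ih w ((hB v hv).2.1 hA w (attr_subset k hw) he) hw
    · obtain ⟨w, hw, he⟩ := (hB v hv).2.2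
      exact ih w hw (h w (hB.subset hw) he)

theorem isTrap_compl_attr [Finite V] (hU : IsSubarena E U) :
    IsTrap E A U {v | v ∈ U ∧ ∀ k, v ∉ attr E A U X k} := by
  rintro v ⟨hv, hk⟩
  have hA : v ∈ A → ∀ w ∈ U, E v w → w ∈ {v | v ∈ U ∧ ∀ k, v ∉ attr E A U X k} :=
    fun hA w hw he => ⟨hw, fun k h => hk (k + 1) (.inr ⟨hv, .inl ⟨hA, w, h, he⟩⟩)⟩
  refine ⟨hv, hA, ?_⟩
  by_cases h : v ∈ A
  · obtain ⟨w, hw, he⟩ := hU v hv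
    exact ⟨w, hA h w hw he, he⟩
  · by_contra hno
    have hall : ∀ w, ∃ k, w ∈ U → E v w → w ∈ attr E A U X k := fun w => by
      by_contra hc
      push Not at hc
      exact hno ⟨w, ⟨(hc 0).1, fun k => (hc k).2.2⟩, (hc 0).2.1⟩
    choose r hr using hall
    -- `V` is finite, so all successors of `v` are attracted within a common number of moves
    obtain ⟨K, hK⟩ := (Set.finite_range r).bddAbove
    exact hk (K + 1) (.inr ⟨hv, .inr ⟨h, fun w hw he =>
      attr_mono (hK ⟨w, rfl⟩) (hr w hw he)⟩⟩)

open Classical in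
/-- A rank function that decreases along the attractor, the complement of a largest trap. -/
theorem IsMaxTrap.exists_rank [Finite V] (hU : IsSubarena E U) (hZ : IsMaxTrap E A U X Z) :
    ∃ r : V → ℕ, ∀ v ∈ U, v ∉ Z → v ∉ X →
      (∃ w ∈ U, w ∉ Z ∧ E v w ∧ r w < r v) ∧
      (v ∉ A → ∀ w ∈ U, E v w → w ∉ Z ∧ r w < r v) := by
  have hex : ∀ v ∈ U, v ∉ Z → ∃ k, v ∈ attr E A U X k := fun v hv hvZ => by
    by_contra h
    push Not at h
    refine hZ.2.2 _ (isTrap_compl_attr (X := X) hU) ?_ v ⟨hv, h⟩ |> hvZ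
    exact fun w hw hX => hw.2 0 ⟨hw.1, hX⟩
  have hnot := hZ.1.not_mem_attr hZ.2.1
  refine ⟨fun v => if h : ∃ k, v ∈ attr E A U X k then Nat.find h else 0, fun v hv hvZ hvX => ?_⟩
  have h := hex v hv hvZ
  have hlt : ∀ k w, w ∈ attr E A U X k → k + 1 = Nat.find h → w ∉ Z ∧
      (if h : ∃ k, w ∈ attr E A U X k then Nat.find h else 0) <
        (if h : ∃ k, v ∈ attr E A U X k then Nat.find h else 0) := fun k w hw e => by
    refine ⟨fun hwZ => hnot k w hwZ hw, ?_⟩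
    rw [dif_pos h, dif_pos ⟨k, hw⟩, ← e]
    exact Nat.lt_succ_of_le (Nat.find_min' _ hw)
  obtain ⟨k, e⟩ : ∃ k, k + 1 = Nat.find h := by
    refine ⟨Nat.find h - 1, Nat.sub_add_cancel (Nat.one_le_iff_ne_zero.2 fun h0 => ?_)⟩
    have := Nat.find_spec h
    rw [h0] at this
    exact hvX this.2
  have hs := Nat.find_spec h
  rw [← e] at hs
  rcases hs with hs | ⟨_, hs⟩
  · exact absurd hs (Nat.find_min h (by omega))
  · have hsucc : v ∉ A → ∀ w ∈ U, E v w → w ∈ attr E A U X k := fun hA =>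
      hs.elim (fun h => absurd h.1 hA) fun h => h.2
    constructor
    · by_cases hA : v ∈ A
      · obtain ⟨w, hw, he⟩ := (hs.resolve_right fun h => h.1 hA).2
        exact ⟨w, attr_subset k hw, (hlt k w hw e).1, he, (hlt k w hw e).2⟩
      · obtain ⟨w, hw, he⟩ := hU v hv
        exact ⟨w, hw, (hlt k w (hsucc hA w hw he) e).1, he, (hlt k w (hsucc hA w hw he) e).2⟩
    · exact fun hA w hw he => hlt k w (hsucc hA w hw he) e

theorem no_descent (f : ℕ → ℕ) : ¬ ∀ i, f (i + 1) < f i := fun h => by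
  have : ∀ i, f i + i ≤ f 0 := fun i => by
    induction i with
    | zero => simp
    | succ i ih => have := h i; omega
  have := this (f 0 + 1)
  omega

/-! ### Soundness of the rules -/

/-- The steps of the strategy that wins on a trap `Z` for its own player, and attracts to the
target from all vertices outside `Z`. -/
inductive ReachStep (M : Machine E A Z ∅ T) (r : V → ℕ) :
    M.State ⊕ {v : V // v ∈ U ∧ v ∉ Z} → M.State ⊕ {v : V // v ∈ U ∧ v ∉ Z} → Prop
  | stay (q q') : M.step q q' → ReachStep M r (.inl q) (.inl q')
  | leave (q v) : E (M.pos q) v.1 → ReachStep M r (.inl q) (.inr v)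
  | approach (v w) : E v.1 w.1 → r w.1 < r v.1 → ReachStep M r (.inr v) (.inr w)

/-- A winning strategy on the complement of the attractor of `X` extends to a strategy on the
whole subarena that wins or reaches `X`. -/
theorem Machine.reach [Finite V] (hU : IsSubarena E U) (hZ : IsMaxTrap E A U X Z)
    (M : Machine E A Z ∅ T) : Nonempty (Machine E A U X T) := by
  classical
  obtain ⟨r, hr⟩ := hZ.exists_rank hU
  refine ⟨{
    State := M.State ⊕ {v : V // v ∈ U ∧ v ∉ Z}
    pos := Sum.elim M.pos Subtype.val
    step := ReachStep M r
    pos_mem := ?_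
    exists_state := ?_
    edge_of_step := ?_
    exists_step := ?_
    exists_step_to := ?_
    wins := ?_ }⟩
  · rintro (q | v)
    · exact hZ.1.subset (M.pos_mem q)
    · exact v.2.1
  · intro v hv
    by_cases hvZ : v ∈ Z
    · obtain ⟨q, hq⟩ := M.exists_state v hvZ
      exact ⟨.inl q, hq⟩
    · exact ⟨.inr ⟨v, hv, hvZ⟩, rfl⟩
  · rintro _ _ (⟨q, q', h⟩ | ⟨q, v, h⟩ | ⟨v, w, h, _⟩)
    · exact M.edge_of_step q q' h
    · exact h
    · exact h
  · rintro (q | v) hX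
    · obtain ⟨q', h⟩ := M.exists_step q (fun h => h)
      exact ⟨_, .stay q q' h⟩
    · obtain ⟨w, hw, hwZ, he, hlt⟩ := (hr v.1 v.2.1 v.2.2 hX).1
      exact ⟨.inr ⟨w, hw, hwZ⟩, .approach v ⟨w, hw, hwZ⟩ he hlt⟩
  · rintro (q | v) w hX hA hw he
    · by_cases hwZ : w ∈ Z
      · obtain ⟨q', h, e⟩ := M.exists_step_to q w (fun h => h) hA hwZ he
        exact ⟨_, .stay q q' h, e⟩
      · exact ⟨.inr ⟨w, hw, hwZ⟩, .leave q ⟨w, hw, hwZ⟩ he, rfl⟩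
    · obtain ⟨hwZ, hlt⟩ := (hr v.1 v.2.1 v.2.2 hX).2 hA w hw he
      exact ⟨.inr ⟨w, hw, hwZ⟩, .approach v ⟨w, hw, hwZ⟩ he hlt, rfl⟩
  · intro s hs
    by_cases h : ∃ i v, s i = .inr v
    · obtain ⟨i, v, hv⟩ := h
      have hall : ∀ j, ∃ v, s (i + j) = .inr v := fun j => by
        induction j with
        | zero => exact ⟨v, hv⟩
        | succ j ih =>
          obtain ⟨w, hw⟩ := ih
          have := hs (i + j)
          rw [hw] at this
          rw [← add_assoc]
          generalize s (i + j + 1) = x at this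
          cases this with
          | approach _ w => exact ⟨w, rfl⟩
      choose t ht using hall
      refine (no_descent (fun j => r (t j).1) fun j => ?_).elim
      have := hs (i + j)
      rw [ht j, show i + j + 1 = i + (j + 1) from rfl, ht (j + 1)] at this
      cases this with
      | approach _ _ _ h => exact h
    · have hall : ∀ i, ∃ q, s i = .inl q := fun i => by
        rcases e : s i with q | v
        · exact ⟨q, rfl⟩
        · exact (h ⟨i, v, e⟩).elim
      choose t ht using hall
      simp only [ht]
      refine M.wins t fun i => ?_
      have := hs i
      rw [ht i, ht (i + 1)] at this
      cases this with
      | stay _ _ h => exact h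

/-- Steps of the strategy that follows `M` until it reaches the region of `N`, and `N` from then
on. -/
inductive ThenStep (M : Machine E A U X T) (N : Machine E A X ∅ T) :
    M.State ⊕ N.State → M.State ⊕ N.State → Prop
  | left (q q') : M.step q q' → ThenStep M N (.inl q) (.inl q')
  | switch (q q₀ q') : N.pos q₀ = M.pos q → N.step q₀ q' → ThenStep M N (.inl q) (.inr q')
  | right (q q') : N.step q q' → ThenStep M N (.inr q) (.inr q')

theorem Machine.andThen (M : Machine E A U X T) (N : Machine E A X ∅ T) (ht : IsTrap E Aᶜ U X) :
    Nonempty (Machine E A U ∅ T) := by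
  refine ⟨{
    State := M.State ⊕ N.State
    pos := Sum.elim M.pos N.pos
    step := ThenStep M N
    pos_mem := ?_
    exists_state := ?_
    edge_of_step := ?_
    exists_step := ?_
    exists_step_to := ?_
    wins := ?_ }⟩
  · rintro (q | q)
    · exact M.pos_mem q
    · exact ht.subset (N.pos_mem q)
  · intro v hv
    obtain ⟨q, hq⟩ := M.exists_state v hv
    exact ⟨.inl q, hq⟩
  · rintro _ _ (⟨q, q', h⟩ | ⟨q, q₀, q', e, h⟩ | ⟨q, q', h⟩)
    · exact M.edge_of_step q q' h
    · have := N.edge_of_step q₀ q' h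
      rw [e] at this
      exact this
    · exact N.edge_of_step q q' h
  · rintro (q | q) -
    · by_cases hX : M.pos q ∈ X
      · obtain ⟨q₀, e⟩ := N.exists_state _ hX
        obtain ⟨q', h⟩ := N.exists_step q₀ (fun h => h)
        exact ⟨_, .switch q q₀ q' e h⟩
      · obtain ⟨q', h⟩ := M.exists_step q hX
        exact ⟨_, .left q q' h⟩
    · obtain ⟨q', h⟩ := N.exists_step q (fun h => h)
      exact ⟨_, .right q q' h⟩
  · have hN : ∀ q w, N.pos q ∉ A → w ∈ U → E (N.pos q) w → ∃ q', N.step q q' ∧ N.pos q' = w :=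
      fun q w hA hw he =>
        N.exists_step_to q w (fun h => h) hA ((ht _ (N.pos_mem q)).2.1 hA w hw he) he
    rintro (q | q) w - hA hw he
    · by_cases hX : M.pos q ∈ X
      · obtain ⟨q₀, e⟩ := N.exists_state _ hX
        obtain ⟨q', h, e'⟩ := hN q₀ w (e ▸ hA) hw (e ▸ he)
        exact ⟨_, .switch q q₀ q' e h, e'⟩
      · obtain ⟨q', h, e⟩ := M.exists_step_to q w hX hA hw he
        exact ⟨_, .left q q' h, e⟩
    · obtain ⟨q', h, e⟩ := hN q w hA hw he
      exact ⟨_, .right q q' h, e⟩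
  · intro s hs
    by_cases h : ∃ i q, s i = .inr q
    · obtain ⟨i, q, hq⟩ := h
      have hall : ∀ j, ∃ q, s (i + j) = .inr q := fun j => by
        induction j with
        | zero => exact ⟨q, hq⟩
        | succ j ih =>
          obtain ⟨w, hw⟩ := ih
          have := hs (i + j)
          rw [hw] at this
          rw [← add_assoc]
          generalize s (i + j + 1) = x at this
          cases this with
          | right _ q' => exact ⟨q', rfl⟩
      choose t ht using hall
      refine N.wins_of_eventually _ i t (fun j => ?_) fun j => by rw [ht j]; rfl
      have := hs (i + j)
      rw [ht j, show i + j + 1 = i + (j + 1) from rfl, ht (j + 1)] at this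
      cases this with
      | right _ _ h => exact h
    · have hall : ∀ i, ∃ q, s i = .inl q := fun i => by
        rcases e : s i with q | v
        · exact ⟨q, rfl⟩
        · exact (h ⟨i, v, e⟩).elim
      choose t ht using hall
      simp only [ht]
      refine M.wins t fun i => ?_
      have := hs i
      rw [ht i, ht (i + 1)] at this
      cases this with
      | left _ _ h => exact h

/-- Steps of the strategy that goes for the targets `e 0`, `e 1`, … in turn. -/
inductive CycleStep {e : ℕ → V} (M : ∀ k, Machine E A U {e k} T) :
    (Σ k, (M k).State) → (Σ k, (M k).State) → Prop
  | stay (k q q') : (M k).step q q' → CycleStep M ⟨k, q⟩ ⟨k, q'⟩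
  | next (k q q') : (M k).pos q = e k → E ((M k).pos q) ((M (k + 1)).pos q') →
      CycleStep M ⟨k, q⟩ ⟨k + 1, q'⟩

theorem CycleStep.of_same {e : ℕ → V} {M : ∀ k, Machine E A U {e k} T} {k : ℕ}
    {q q' : (M k).State} (h : CycleStep M ⟨k, q⟩ ⟨k, q'⟩) : (M k).step q q' := by
  generalize hx : (⟨k, q⟩ : Σ k, (M k).State) = x, hy : (⟨k, q'⟩ : Σ k, (M k).State) = y at h
  cases h with
  | stay k' q₁ q₂ h =>
    cases hx
    cases hy
    exact h
  | next k' q₁ q₂ =>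
    have h1 := congrArg Sigma.fst hx
    have h2 := congrArg Sigma.fst hy
    simp only at h1 h2
    omega

/-- If every vertex of `U` can be made a target, and visiting all of `U` infinitely often is a win,
then the player who goes for all vertices in turn wins. -/
theorem Machine.cycle {e : ℕ → V} (he : ∀ v ∈ U, ∀ n, ∃ k, n ≤ k ∧ e k = v)
    (hU : IsSubarena E U) (hT : U ∈ T) (M : ∀ k, Machine E A U {e k} T) :
    Nonempty (Machine E A U ∅ T) := by
  have next : ∀ k q w, (M k).pos q = e k → w ∈ U → E ((M k).pos q) w →
      ∃ x : Σ k, (M k).State, CycleStep M ⟨k, q⟩ x ∧ (M x.1).pos x.2 = w :=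
    fun k q w h hw hE => by
      obtain ⟨q', rfl⟩ := (M (k + 1)).exists_state w hw
      exact ⟨⟨k + 1, q'⟩, .next k q q' h hE, rfl⟩
  refine ⟨{
    State := Σ k, (M k).State
    pos := fun x => (M x.1).pos x.2
    step := CycleStep M
    pos_mem := fun x => (M x.1).pos_mem x.2
    exists_state := ?_
    edge_of_step := ?_
    exists_step := ?_
    exists_step_to := ?_
    wins := ?_ }⟩
  · intro v hv
    obtain ⟨q, hq⟩ := (M 0).exists_state v hv
    exact ⟨⟨0, q⟩, hq⟩
  · rintro _ _ (⟨k, q, q', h⟩ | ⟨k, q, q', _, h⟩)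
    · exact (M k).edge_of_step q q' h
    · exact h
  · rintro ⟨k, q⟩ -
    by_cases h : (M k).pos q = e k
    · obtain ⟨w, hw, hE⟩ := hU _ ((M k).pos_mem q)
      obtain ⟨x, hx, _⟩ := next k q w h hw hE
      exact ⟨x, hx⟩
    · obtain ⟨q', h⟩ := (M k).exists_step q h
      exact ⟨_, .stay k q q' h⟩
  · rintro ⟨k, q⟩ w - hA hw hE
    by_cases h : (M k).pos q = e k
    · exact next k q w h hw hE
    · obtain ⟨q', h, e'⟩ := (M k).exists_step_to q w h hA hw hE
      exact ⟨⟨k, q'⟩, .stay k q q' h, e'⟩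
  · intro s hs
    have hstep : ∀ i, (s (i + 1)).1 = (s i).1 ∨
        ((s (i + 1)).1 = (s i).1 + 1 ∧ (M (s i).1).pos (s i).2 = e (s i).1) := fun i => by
      have := hs i
      generalize s i = x, s (i + 1) = y at this ⊢
      cases this with
      | stay => exact .inl rfl
      | next _ _ _ h => exact .inr ⟨rfl, h⟩
    have hmono : Monotone fun i => (s i).1 := monotone_nat_of_le_succ fun i => by
      show (s i).1 ≤ (s (i + 1)).1
      rcases hstep i with h | h <;> omega
    by_cases hb : ∃ N, ∀ i, (s (N + i)).1 = (s N).1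
    · -- the target is never reached again from some point on
      obtain ⟨N, hN⟩ := hb
      have hall : ∀ i, ∃ q : (M (s N).1).State, s (N + i) = ⟨(s N).1, q⟩ := fun i => by
        have := hN i
        generalize (s N).1 = k at this ⊢
        generalize s (N + i) = x at this ⊢
        subst this
        exact ⟨x.2, rfl⟩
      choose t ht using hall
      refine (M (s N).1).wins_of_eventually _ N t (fun i => ?_) fun i => by rw [ht i]
      have := hs (N + i)
      rw [ht i, show N + i + 1 = N + (i + 1) from rfl, ht (i + 1)] at this
      exact this.of_same
    · -- otherwise all targets are reached
      have hpass : ∀ n, ∃ i, n ≤ (s i).1 := fun n => by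
        induction n with
        | zero => exact ⟨0, Nat.zero_le _⟩
        | succ n ih =>
          obtain ⟨i, hi⟩ := ih
          by_contra hc
          push Not at hc
          refine hb ⟨i, fun j => ?_⟩
          have h1 := hc (i + j)
          have h2 : (s i).1 ≤ (s (i + j)).1 := hmono (Nat.le_add_right i j)
          omega
      have hinf : infSet (fun i => (M (s i).1).pos (s i).2) = U := by
        ext v
        constructor
        · intro h
          obtain ⟨j, -, rfl⟩ := h 0
          exact (M _).pos_mem _
        · intro hv n
          obtain ⟨k, hk, hek⟩ := he v hv ((s n).1)
          -- the first moment at which the index of the target exceeds `k`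
          have hex := hpass (k + 1)
          classical
          obtain ⟨i, hi, hmin⟩ : ∃ i, k + 1 ≤ (s i).1 ∧ ∀ j < i, ¬ k + 1 ≤ (s j).1 :=
            ⟨Nat.find hex, Nat.find_spec hex, fun j hj => Nat.find_min hex hj⟩
          have hni : n < i := by
            by_contra h
            have : (s i).1 ≤ (s n).1 := hmono (not_lt.1 h)
            omega
          obtain ⟨j, rfl⟩ : ∃ j, i = j + 1 := ⟨i - 1, by omega⟩
          have h1 := hmin j (Nat.lt_succ_self j)
          rcases hstep j with h | ⟨h, hp⟩
          · omega
          · refine ⟨j, by omega, ?_⟩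
            have : (s j).1 = k := by omega
            exact hp.trans ((congrArg e this).trans hek)
      rw [hinf]
      exact hT

/-- **Soundness**: a derivable set of vertices carries a winning strategy. -/
theorem WinsAll.exists_machine [Finite V] (h : WinsAll E A T U) :
    Nonempty (Machine E A U ∅ T) := by
  have hempty : Nonempty (Machine E A ∅ ∅ T) :=
    ⟨⟨Empty, Empty.elim, fun _ _ => False, fun q => q.elim, fun _ h => h.elim, fun q => q.elim,
      fun q => q.elim, fun q => q.elim, fun s => (s 0).elim⟩⟩
  refine h {U | Nonempty (Machine E A U ∅ T)} ⟨hempty, ?_, ?_⟩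
  · intro U hU hT h
    rcases U.eq_empty_or_nonempty with rfl | hne
    · exact hempty
    have : Nonempty U := hne.to_subtype
    obtain ⟨f, hf⟩ := exists_surjective_nat U
    -- every vertex is a target infinitely often
    have he : ∀ v ∈ U, ∀ n, ∃ k : ℕ, n ≤ k ∧ (f k.unpair.1).1 = v := fun v hv n => by
      obtain ⟨a, ha⟩ := hf ⟨v, hv⟩
      exact ⟨Nat.pair a n, Nat.right_le_pair a n, by rw [Nat.unpair_pair, ha]⟩
    have hM : ∀ k : ℕ, Nonempty (Machine E A U {(f k.unpair.1).1} T) := fun k => by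
      obtain ⟨Z, ⟨M⟩, hZ⟩ := h _ (f k.unpair.1).2
      exact M.reach hU hZ
    exact Machine.cycle he hU hT fun k => (hM k).some
  · rintro U X Z hU ⟨N⟩ ⟨M⟩ ht hm
    obtain ⟨M'⟩ := M.reach hU hm
    exact M'.andThen N ht

end Machines

/-! ### Regions in which a player can force a win -/

theorem IsTrap.of_closed {V : Type} {E : V → V → Prop} {A U B : Set V} (h : IsTrap E A U B)
    (hU : ∀ v ∈ U, ∀ w, E v w → w ∈ U) : IsTrap E A Set.univ B :=
  fun v hv => ⟨trivial, fun hA w _ he => (h v hv).2.1 hA w (hU v (h.subset hv) w he) he,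
    (h v hv).2.2⟩

/-- The player who controls `A` has a region, containing `v`, that his opponent cannot leave and in
which he wins with respect to the Muller condition `T`. -/
def CanForce {V : Type} (E : V → V → Prop) (A : Set V) (T : Set (Set V)) (v : V) : Prop :=
  ∃ X : Set V, v ∈ X ∧ IsTrap E Aᶜ Set.univ X ∧ WinsAll E A T X

namespace Arena

variable {P V : Type} {G : Arena P V}

/-! ### Profiles and the plays that follow them -/

/-- The move that a strategy profile prescribes after a history. -/
def move (σ : G.Profile) (h : List V) (v : V) (hh : G.IsHist h v) : V :=
  (σ (G.owner v)).next h v hh rfl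

theorem move_congr (σ : G.Profile) {h h' : List V} {v v' : V} (hh : G.IsHist h v)
    (hh' : G.IsHist h' v') (e : h = h') (e' : v = v') : move σ h v hh = move σ h' v' hh' := by
  subst e e'
  rfl

theorem next_eq_move (σ : G.Profile) {p : P} {h : List V} {v : V} (hh : G.IsHist h v)
    (hp : G.owner v = p) : (σ p).next h v hh hp = move σ h v hh := by
  subst hp
  rfl

theorem edge_move (σ : G.Profile) {h : List V} {v : V} (hh : G.IsHist h v) :
    G.edge v (move σ h v hh) :=
  (σ (G.owner v)).legal h v hh rfl

/-- The play `ρ` follows the profile `σ` at all vertices of `B`. -/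
def Follows (σ : G.Profile) (B : Set V) (ρ : ℕ → V) : Prop :=
  ∃ hρ : ρ ∈ G.Play, ∀ i, ρ i ∈ B →
    ρ (i + 1) = move σ ((List.range i).map ρ) (ρ i) (isHist_of_play hρ i)

theorem run_hist (σ : G.Profile) (n : ℕ) : (G.run σ n).1.1 = (List.range n).map (G.out σ) := by
  induction n with
  | zero => rfl
  | succ n ih =>
    rw [List.range_succ, List.map_append, ← ih]
    rfl

theorem out_mem_play (σ : G.Profile) : G.out σ ∈ G.Play :=
  ⟨rfl, fun i => edge_move σ (G.run σ i).2⟩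

theorem follows_out (σ : G.Profile) : Follows σ Set.univ (G.out σ) :=
  ⟨out_mem_play σ, fun i _ => move_congr σ (G.run σ i).2 _ (run_hist σ i) rfl⟩

theorem range_map_congr {ρ ρ' : ℕ → V} {n : ℕ} (h : ∀ i < n, ρ i = ρ' i) :
    (List.range n).map ρ = (List.range n).map ρ' :=
  List.map_congr_left fun i hi => h i (List.mem_range.1 hi)

/-- Two plays that follow the same profile wherever the first of them goes agree. -/
theorem eq_of_follows {σ : G.Profile} {B : Set V} {ρ ρ' : ℕ → V} (h : Follows σ B ρ)
    (h' : Follows σ Set.univ ρ') {n : ℕ} (hB : ∀ i < n, ρ i ∈ B) : ∀ i ≤ n, ρ i = ρ' i := by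
  intro i
  induction i using Nat.strong_induction_on with
  | _ i ih =>
    intro hi
    obtain ⟨hρ, h⟩ := h
    obtain ⟨hρ', h'⟩ := h'
    cases i with
    | zero => rw [hρ.1, hρ'.1]
    | succ i =>
      rw [h i (hB i hi), h' i trivial]
      exact move_congr σ _ _ (range_map_congr fun j hj => ih j (by omega) (by omega))
        (ih i (by omega) (by omega))

theorem follows_univ_iff {σ : G.Profile} {ρ : ℕ → V} : Follows σ Set.univ ρ ↔ ρ = G.out σ := by
  constructor
  · exact fun h => funext fun n => eq_of_follows h (follows_out σ) (fun _ _ => trivial) n le_rfl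
  · rintro rfl
    exact follows_out σ

theorem mem_outOf_iff {σ : G.Profile} {p : P} {ρ : ℕ → V} :
    ρ ∈ G.outOf (σ p) ↔ Follows σ {v | G.owner v = p} ρ := by
  constructor
  · rintro ⟨hρ, h⟩
    exact ⟨hρ, fun i hi => (h i hi).trans (next_eq_move σ _ hi)⟩
  · rintro ⟨hρ, h⟩
    exact ⟨hρ, fun i hi => (h i hi).trans (next_eq_move σ _ hi).symm⟩

open Classical in
theorem follows_update {σ : G.Profile} {p : P} {τ : G.Strategy p} {ρ : ℕ → V} :
    Follows (Function.update σ p τ) {v | G.owner v ≠ p} ρ ↔ Follows σ {v | G.owner v ≠ p} ρ := by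
  have : ∀ h v hh, G.owner v ≠ p → move (Function.update σ p τ) h v hh = move σ h v hh :=
    fun h v hh hv => by rw [move, move, Function.update_of_ne hv]
  constructor
  · rintro ⟨hρ, h⟩
    exact ⟨hρ, fun i hi => (h i hi).trans (this _ _ _ hi)⟩
  · rintro ⟨hρ, h⟩
    exact ⟨hρ, fun i hi => (h i hi).trans (this _ _ _ hi).symm⟩

theorem exists_succ_of_isHist {h : List V} {v : V} (hh : G.IsHist h v) : ∃ w, G.edge v w := by
  obtain ⟨ρ, hρ, n, rfl, rfl⟩ := hh
  exact ⟨_, hρ.2 n⟩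

open Classical in
/-- The strategy that moves according to `f` whenever `f` suggests a legal move. -/
noncomputable def strategyOf (G : Arena P V) (f : List V → V → V) (p : P) : G.Strategy p where
  next h v hh _ := if G.edge v (f h v) then f h v else (exists_succ_of_isHist hh).choose
  legal h v hh _ := by
    split_ifs with he
    · exact he
    · exact (exists_succ_of_isHist hh).choose_spec

theorem strategyOf_next {f : List V → V → V} {p : P} {h : List V} {v : V} (hh : G.IsHist h v)
    (hp : G.owner v = p) (he : G.edge v (f h v)) :
    (G.strategyOf f p).next h v hh hp = f h v :=
  if_pos he

open Classical in
/-- The outcomes that a deviation of player `p` can produce are the plays that follow the profile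
at the vertices of the other players. -/
theorem exists_out_update_iff {σ : G.Profile} {p : P} {ρ : ℕ → V} :
    (∃ τ : G.Strategy p, G.out (Function.update σ p τ) = ρ) ↔
      Follows σ {v | G.owner v ≠ p} ρ := by
  constructor
  · rintro ⟨τ, rfl⟩
    rw [← follows_update (τ := τ)]
    obtain ⟨hρ, h⟩ := follows_out (Function.update σ p τ)
    exact ⟨hρ, fun i _ => h i trivial⟩
  · intro h
    let τ := G.strategyOf (fun h _ => ρ (h.length + 1)) p
    refine ⟨τ, (follows_univ_iff.1 ?_).symm⟩
    obtain ⟨hρ, h'⟩ := (follows_update (τ := τ)).2 h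
    refine ⟨hρ, fun i _ => ?_⟩
    by_cases hi : G.owner (ρ i) = p
    · rw [← next_eq_move _ _ hi, Function.update_self, strategyOf_next]
      · simp
      · simpa using hρ.2 i
    · exact h' i hi

/-! ### Strategies with memory -/

/-- The state reached by a deterministic automaton after the history `h v`; the initial vertex,
being the same for all histories, is not read. -/
def track {Q : Type} (δ : Q → V → Q) (q₀ : Q) (h : List V) (v : V) : Q :=
  (h ++ [v]).tail.foldl δ q₀

/-- The states of a deterministic automaton along a play. -/
def trackSeq {Q : Type} (δ : Q → V → Q) (q₀ : Q) (ρ : ℕ → V) : ℕ → Q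
  | 0 => q₀
  | n + 1 => δ (trackSeq δ q₀ ρ n) (ρ (n + 1))

theorem track_eq {Q : Type} (δ : Q → V → Q) (q₀ : Q) (ρ : ℕ → V) (n : ℕ) :
    track δ q₀ ((List.range n).map ρ) (ρ n) = trackSeq δ q₀ ρ n := by
  have e : (List.range n).map ρ ++ [ρ n] = (List.range (n + 1)).map ρ := by
    rw [List.range_succ, List.map_append]; rfl
  rw [track, e, List.range_succ_eq_map, List.map_cons, List.tail_cons]
  induction n with
  | zero => rfl
  | succ n ih =>
    rw [List.range_succ, List.map_append, List.map_append, List.foldl_append, ih]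
    · rfl
    · rw [List.range_succ, List.map_append]; rfl

/-- A profile can play by the output `g` of an automaton that reads the history. -/
theorem exists_profile_of_track {Q : Type} (G : Arena P V) (δ : Q → V → Q) (q₀ : Q) (g : Q → V) :
    ∃ σ : G.Profile, ∀ (B : Set V) (ρ : ℕ → V), Follows σ B ρ → ∀ i, ρ i ∈ B →
      G.edge (ρ i) (g (trackSeq δ q₀ ρ i)) → ρ (i + 1) = g (trackSeq δ q₀ ρ i) := by
  refine ⟨fun p => G.strategyOf (fun h v => g (track δ q₀ h v)) p, ?_⟩
  rintro B ρ ⟨hρ, h⟩ i hi he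
  rw [h i hi, move, strategyOf_next, track_eq]
  rw [track_eq]
  exact he

/-! ### From certificates to strategies and counterplays -/

theorem _root_.Machine.exists_step_to_of_isTrap {A X : Set V} {T : Set (Set V)}
    (M : Machine G.edge A X ∅ T)
    (ht : IsTrap G.edge Aᶜ Set.univ X) {q : M.State} {w : V} (hA : M.pos q ∉ A)
    (he : G.edge (M.pos q) w) : ∃ q', M.step q q' ∧ M.pos q' = w :=
  M.exists_step_to q w (fun h => h) hA ((ht _ (M.pos_mem q)).2.1 hA w trivial he) he

open Classical in
/-- Determinization of a winning strategy: one of its steps that lead to a given vertex. -/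
noncomputable def _root_.Machine.read {A X : Set V} {T : Set (Set V)} (M : Machine G.edge A X ∅ T)
    (q : M.State) (w : V) : M.State :=
  if h : ∃ q', M.step q q' ∧ M.pos q' = w then h.choose else q

/-- A legal move that the winning strategy allows. -/
noncomputable def _root_.Machine.say {A X : Set V} {T : Set (Set V)} (M : Machine G.edge A X ∅ T)
    (q : M.State) : V :=
  M.pos (M.exists_step q (fun h => h)).choose

theorem _root_.Machine.edge_say {A X : Set V} {T : Set (Set V)} (M : Machine G.edge A X ∅ T)
    (q : M.State) : G.edge (M.pos q) (M.say q) :=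
  M.edge_of_step _ _ (M.exists_step q (fun h => h)).choose_spec

theorem _root_.Machine.read_spec {A X : Set V} {T : Set (Set V)} (M : Machine G.edge A X ∅ T)
    (ht : IsTrap G.edge Aᶜ Set.univ X) {q : M.State} {w : V} (he : G.edge (M.pos q) w)
    (hA : M.pos q ∈ A → w = M.say q) :
    M.step q (M.read q w) ∧ M.pos (M.read q w) = w := by
  have h : ∃ q', M.step q q' ∧ M.pos q' = w := by
    by_cases hq : M.pos q ∈ A
    · exact ⟨_, (M.exists_step q (fun h => h)).choose_spec, (hA hq).symm⟩
    · exact M.exists_step_to_of_isTrap ht hq he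
  rw [Machine.read, dif_pos h]
  exact h.choose_spec

/-- A word that obeys the determinized winning strategy from some position on satisfies the
winning condition. -/
theorem _root_.Machine.infSet_mem_of_read {A X : Set V} {T : Set (Set V)}
    (M : Machine G.edge A X ∅ T) (ht : IsTrap G.edge Aᶜ Set.univ X) {ρ : ℕ → V}
    (n : ℕ) (s : ℕ → M.State)
    (hρ : ∀ i, G.edge (ρ i) (ρ (i + 1))) (h0 : M.pos (s 0) = ρ n)
    (hs : ∀ i, s (i + 1) = M.read (s i) (ρ (n + (i + 1))))
    (hA : ∀ i, M.pos (s i) = ρ (n + i) → ρ (n + i) ∈ A → ρ (n + (i + 1)) = M.say (s i)) :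
    infSet ρ ∈ T := by
  have step : ∀ i, M.pos (s i) = ρ (n + i) →
      M.step (s i) (s (i + 1)) ∧ M.pos (s (i + 1)) = ρ (n + (i + 1)) := fun i hi => by
    rw [hs i]
    refine M.read_spec ht ?_ fun h => hA i hi (hi ▸ h)
    rw [hi]
    exact hρ (n + i)
  have hpos : ∀ i, M.pos (s i) = ρ (n + i) := fun i => by
    induction i with
    | zero => exact h0
    | succ i ih => exact (step i ih).2
  exact M.wins_of_eventually ρ n s (fun i => (step i (hpos i)).1) fun i => (hpos i).symm

/-- After any history that ends in the winning region `X` of the player who controls `A`, there is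
a play won by him that follows the given profile at all vertices outside `A`. -/
theorem exists_play_of_machine (σ : G.Profile) {A X : Set V} {T : Set (Set V)}
    (M : Machine G.edge A X ∅ T) (ht : IsTrap G.edge Aᶜ Set.univ X) {h : List V} {v : V}
    (hh : G.IsHist h v) (hv : v ∈ X) :
    ∃ (ρ : ℕ → V) (hρ : ρ ∈ G.Play) (n : ℕ), h = (List.range n).map ρ ∧ v = ρ n ∧ infSet ρ ∈ T ∧
      ∀ i, n ≤ i → ρ i ∉ A →
        ρ (i + 1) = move σ ((List.range i).map ρ) (ρ i) (isHist_of_play hρ i) := by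
  let S := {x : List V × M.State // G.IsHist x.1 (M.pos x.2)}
  have hstep : ∀ x : S, ∃ q', M.step x.1.2 q' ∧
      (M.pos x.1.2 ∉ A → M.pos q' = move σ x.1.1 (M.pos x.1.2) x.2) := fun x => by
    by_cases hA : M.pos x.1.2 ∈ A
    · obtain ⟨q', hq'⟩ := M.exists_step x.1.2 (fun h => h)
      exact ⟨q', hq', fun h => absurd hA h⟩
    · obtain ⟨q', hq', e⟩ := M.exists_step_to_of_isTrap ht hA (edge_move σ x.2)
      exact ⟨q', hq', fun _ => e⟩
  choose g hg hgm using hstep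
  obtain ⟨q₀, rfl⟩ := M.exists_state v hv
  let next : S → S := fun x => ⟨(x.1.1 ++ [M.pos x.1.2], g x),
    x.2.snoc (M.edge_of_step _ _ (hg x))⟩
  let x : ℕ → S := fun i => next^[i] ⟨(h, q₀), hh⟩
  have hx : ∀ i, x (i + 1) = next (x i) := fun i => Function.iterate_succ_apply' _ _ _
  obtain ⟨ρ₀, hρ₀, n, e, e'⟩ := id hh
  let ρ : ℕ → V := fun i => if i < n then ρ₀ i else M.pos (x (i - n)).1.2
  have hlt : ∀ i < n, ρ i = ρ₀ i := fun i hi => if_pos hi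
  have hge : ∀ i, ρ (n + i) = M.pos (x i).1.2 := fun i => by
    show (if n + i < n then _ else _) = _
    rw [if_neg (by omega), Nat.add_sub_cancel_left]
  have hn : ρ n = ρ₀ n := (hge 0).trans e'
  have hρ : ρ ∈ G.Play := by
    constructor
    · rcases Nat.eq_zero_or_pos n with h0 | h0
      · rw [← hρ₀.1]
        rw [h0] at hn
        exact hn
      · rw [hlt 0 h0]; exact hρ₀.1
    · intro i
      rcases lt_trichotomy (i + 1) n with h | h | h
      · rw [hlt i (by omega), hlt _ h]; exact hρ₀.2 i
      · have := hρ₀.2 i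
        rw [hlt i (by omega)]
        rw [h] at this ⊢
        rw [hn]
        exact this
      · obtain ⟨j, rfl⟩ : ∃ j, i = n + j := ⟨i - n, by omega⟩
        rw [hge, add_assoc, hge, hx]
        exact M.edge_of_step _ _ (hg (x j))
  have hhist : ∀ i, (x i).1.1 = (List.range (n + i)).map ρ := fun i => by
    induction i with
    | zero => exact e.trans (range_map_congr fun i hi => (hlt i hi).symm)
    | succ i ih =>
      rw [hx, ← add_assoc, List.range_succ, List.map_append, ← ih]
      show _ ++ [M.pos (x i).1.2] = _ ++ [ρ (n + i)]
      rw [hge]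
  refine ⟨ρ, hρ, n, hhist 0, (hge 0).symm, ?_, ?_⟩
  · refine M.wins_of_eventually ρ n (fun i => (x i).1.2) (fun i => ?_) hge
    rw [hx]
    exact hg (x i)
  · intro i hi hA
    obtain ⟨j, rfl⟩ : ∃ j, i = n + j := ⟨i - n, by omega⟩
    have h1 : ρ (n + j + 1) = M.pos (g (x j)) := by rw [add_assoc, hge, hx]
    have h2 := hgm (x j) (by rw [← hge]; exact hA)
    rw [h1, h2]
    exact move_congr σ _ _ (hhist j) (hge j).symm

/-! ### Winnable objectives -/

theorem isSubarena_reachable (G : Arena P V) :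
    IsSubarena G.edge {v | Relation.ReflTransGen G.edge G.init v} := fun v hv =>
  let ⟨w, hw⟩ := G.exists_succ v hv
  ⟨w, hv.tail hw, hw⟩

/-- Determinacy for the vertices reachable in an arena. -/
theorem exists_isPartition_reachable [Finite V] (G : Arena P V) (A : Set V) (T : Set (Set V)) :
    ∃ X, IsTrap G.edge Aᶜ Set.univ X ∧ WinsAll G.edge A T X ∧
      ∃ Y, IsTrap G.edge A Set.univ Y ∧ WinsAll G.edge Aᶜ Tᶜ Y ∧
        ∀ v, Relation.ReflTransGen G.edge G.init v → v ∉ X → v ∈ Y := by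
  obtain ⟨X, h1, h2, h3, h4⟩ := exists_isPartition A T (isSubarena_reachable G)
  have hc : ∀ v ∈ {v | Relation.ReflTransGen G.edge G.init v}, ∀ w, G.edge v w →
      w ∈ {v | Relation.ReflTransGen G.edge G.init v} := fun v hv w he =>
    Relation.ReflTransGen.tail hv he
  exact ⟨X, h1.of_closed hc, h2, _, h3.of_closed hc, h4, fun v hv hX => ⟨hv, hX⟩⟩

open Classical in
/-- The winnable Muller objectives are those with a certificate. -/
theorem muller_mem_winnable_iff [Finite V] (G : Arena P V) (p : P) (F : Set (Set V)) :
    G.muller F ∈ G.Winnable p ↔ CanForce G.edge {v | G.owner v = p} F G.init := by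
  constructor
  · rintro ⟨τ, hτ⟩
    obtain ⟨X, h1, h2, Y, h3, h4, h5⟩ :=
      exists_isPartition_reachable G {v | G.owner v = p} F
    refine ⟨X, by_contra fun hX => ?_, h1, h2⟩
    obtain ⟨M⟩ := h4.exists_machine
    let σ : G.Profile := Function.update (fun q => G.strategyOf (fun _ v => v) q) p τ
    have hστ : σ p = τ := Function.update_self ..
    obtain ⟨ρ, hρ, n, hn, -, hF, hf⟩ := exists_play_of_machine σ M
      (by rw [compl_compl]; exact h3) G.isHist_init (h5 _ .refl hX)
    have hn0 : n = 0 := by simpa using (congrArg List.length hn).symm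
    refine hF (hτ ?_).2
    rw [← hστ, mem_outOf_iff]
    exact ⟨hρ, fun i hi => hf i (by omega) fun h => h hi⟩
  · rintro ⟨X, hX, ht, hw⟩
    obtain ⟨M⟩ := hw.exists_machine
    obtain ⟨q₀, hq₀⟩ := M.exists_state _ hX
    obtain ⟨σ, hσ⟩ := exists_profile_of_track G M.read q₀ M.say
    refine ⟨σ p, fun ρ hρ => ?_⟩
    have hf := mem_outOf_iff.1 hρ
    obtain ⟨hplay, -⟩ := id hf
    refine ⟨hplay, M.infSet_mem_of_read ht 0 (trackSeq M.read q₀ ρ) hplay.2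
      (hq₀.trans hplay.1.symm) (fun i => ?_) fun i hi hA => ?_⟩
    · rw [zero_add]; rfl
    · rw [zero_add] at hi hA ⊢
      refine hσ _ ρ hf i hA ?_
      rw [← hi]
      exact M.edge_say _

end Arena

/-! ### Decidable conditions for the existence of equilibria -/

section Conditions

variable {P V : Type}

/-- If a player controls `A` and has the Muller condition `F`, and the outcome has the set `S` of
vertices visited infinitely often, then `tolerated E A F v₀ knw S` contains the sets that his
deviations may lead to without enlarging his set of candidate objectives. -/
def tolerated (E : V → V → Prop) (A : Set V) (F : Set (Set V)) (v₀ : V) (knw : Knowledge)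
    (S : Set V) : Set (Set V) :=
  {T | T = S ∨ match knw with
    | .pw => False
    | .gw => T ∈ F ↔ S ∈ F
    | .pg => ¬ CanForce E A {S}ᶜ v₀
    | .pgw => S ∉ F ∧ T ∉ F ∧ CanForce E A {S} v₀}

/-- Whatever move the player makes from a vertex of `Y`, he is confined to a region `X` in which the
coalition of the others enforces a tolerated set. -/
def IsConfined (E : V → V → Prop) (A : Set V) (F : Set (Set V)) (v₀ : V) (knw : Knowledge)
    (S Y : Set V) : Prop :=
  ∃ X : Set V, IsTrap E A Set.univ X ∧ WinsAll E Aᶜ (tolerated E A F v₀ knw S) X ∧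
    ∀ v ∈ Y, v ∈ A → ∀ w, E v w → w ∈ X

/-- There is a path from `v₀`, inside a set `Y`, that visits exactly the vertices of `S` infinitely
often, and every player is confined when he leaves it. The path is expressed as a win in the game
on `Y` without opponent. -/
def HasCertificate (E : V → V → Prop) (own : P → Set V) (F : P → Set (Set V)) (v₀ : V)
    (knw : Knowledge) : Prop :=
  ∃ S Y : Set V, v₀ ∈ Y ∧ WinsAll E Set.univ {S} Y ∧
    ∀ p, IsConfined E (own p) (F p) v₀ knw S Y

/-- There is no branching at the vertices reachable from `v₀`. -/
def IsDeterministic (E : V → V → Prop) (v₀ : V) : Prop :=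
  ∃ Y : Set V, v₀ ∈ Y ∧
    ∀ v ∈ Y, (∀ w, E v w → w ∈ Y) ∧ ∀ w w', E v w → E v w' → w = w'

theorem self_mem_tolerated {E : V → V → Prop} {A : Set V} {F : Set (Set V)} {v₀ : V}
    {knw : Knowledge} {S : Set V} : S ∈ tolerated E A F v₀ knw S := .inl rfl

end Conditions

namespace Arena

variable {P V : Type} {G : Arena P V}

/-! ### Equilibria as winning conditions for coalitions -/

/-- If, after each deviation of a single player `p` from the path `ρ`, the others can enforce the
condition `Good p`, then a profile with outcome `ρ` does so for all deviations. -/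
theorem exists_profile_of_machines {ρ : ℕ → V} (hρ : ρ ∈ G.Play) {Good : P → Set (Set V)}
    (hgood : ∀ p, infSet ρ ∈ Good p) (X : P → Set V)
    (M : ∀ p, Machine G.edge {v | G.owner v = p}ᶜ (X p) ∅ (Good p))
    (ht : ∀ p, IsTrap G.edge {v | G.owner v = p} Set.univ (X p))
    (hX : ∀ i w, G.edge (ρ i) w → w ∈ X (G.owner (ρ i))) :
    ∃ σ : G.Profile, G.out σ = ρ ∧
      ∀ p ρ', Follows σ {v | G.owner v ≠ p} ρ' → infSet ρ' ∈ Good p := by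
  classical
  -- the state `inl i` means that `ρ` has been followed up to time `i`; the state `inr ⟨p, q⟩`
  -- means that `p` has deviated and is being punished by means of `M p`
  let δ : ℕ ⊕ (Σ p, (M p).State) → V → ℕ ⊕ (Σ p, (M p).State) := fun x w =>
    Sum.elim (fun i => if w = ρ (i + 1) then .inl (i + 1) else
        if h : ∃ q, (M (G.owner (ρ i))).pos q = w then .inr ⟨G.owner (ρ i), h.choose⟩ else .inl i)
      (fun y => .inr ⟨y.1, (M y.1).read y.2 w⟩) x
  let g : ℕ ⊕ (Σ p, (M p).State) → V :=
    Sum.elim (fun i => ρ (i + 1)) fun y => (M y.1).say y.2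
  obtain ⟨σ, hσ⟩ := exists_profile_of_track G δ (.inl 0) g
  have main : ∀ (B : Set V) (ρ' : ℕ → V), Follows σ B ρ' → ρ' = ρ ∨
      ∃ n, trackSeq δ (.inl 0) ρ' n = .inl n ∧ ρ' n = ρ n ∧ ρ' (n + 1) ≠ ρ (n + 1) ∧
        ρ' n ∉ B := by
    intro B ρ' hf
    by_cases h : ∃ n, ρ' n ≠ ρ n
    · right
      have hmin : ∀ i < Nat.find h, ρ' i = ρ i := fun i hi => not_not.1 (Nat.find_min h hi)
      obtain ⟨n, hn⟩ : ∃ n, Nat.find h = n + 1 := by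
        refine ⟨Nat.find h - 1, (Nat.sub_add_cancel (Nat.one_le_iff_ne_zero.2 fun h0 => ?_)).symm⟩
        have := Nat.find_spec h
        rw [h0] at this
        exact this (hf.1.1.trans hρ.1.symm)
      have hne : ρ' (n + 1) ≠ ρ (n + 1) := hn ▸ Nat.find_spec h
      have htr : ∀ i ≤ n, trackSeq δ (.inl 0) ρ' i = .inl i := fun i => by
        induction i with
        | zero => exact fun _ => rfl
        | succ i ih =>
          intro hi
          rw [trackSeq, ih (by omega)]
          exact if_pos (hmin (i + 1) (by omega))
      refine ⟨n, htr n le_rfl, hmin n (by omega), hne, fun hB => hne ?_⟩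
      have := hσ B ρ' hf n hB
      rw [htr n le_rfl] at this
      refine this ?_
      rw [hmin n (by omega)]
      exact hρ.2 n
    · push Not at h
      exact .inl (funext h)
  refine ⟨σ, ?_, fun p ρ' hf => ?_⟩
  · rcases main _ _ (follows_out σ) with h | ⟨n, _, _, _, h⟩
    · exact h
    · exact absurd trivial h
  · rcases main _ _ hf with rfl | ⟨n, hn, hρn, hne, hp⟩
    · exact hgood p
    have hp : G.owner (ρ n) = p := by
      rw [← hρn]; exact not_not.1 hp
    subst hp
    set p := G.owner (ρ n) with hpdef
    obtain ⟨hplay, -⟩ := id hf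
    have hex : ∃ q, (M p).pos q = ρ' (n + 1) :=
      (M p).exists_state _ (hX n _ (by rw [← hρn]; exact hplay.2 n))
    let s : ℕ → (M p).State := fun i =>
      Nat.rec hex.choose (fun i q => (M p).read q (ρ' (n + 1 + (i + 1)))) i
    have hs : ∀ i, trackSeq δ (.inl 0) ρ' (n + 1 + i) = .inr ⟨p, s i⟩ := fun i => by
      induction i with
      | zero =>
        rw [add_zero, trackSeq, hn]
        exact (if_neg hne).trans (dif_pos hex)
      | succ i ih =>
        rw [← add_assoc, trackSeq, ih]
        rfl
    refine (M p).infSet_mem_of_read (by rw [compl_compl]; exact ht p) (n + 1) s hplay.2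
      hex.choose_spec (fun _ => rfl) fun i hi hA => ?_
    have := hσ _ ρ' hf (n + 1 + i) hA
    rw [hs i] at this
    refine this ?_
    rw [← hi]
    exact (M p).edge_say _

theorem exists_path_of_winsAll [Finite V] {S Y : Set V} {v : V} (hv : v ∈ Y)
    (hY : WinsAll G.edge Set.univ {S} Y) :
    ∃ ρ : ℕ → V, ρ 0 = v ∧ (∀ i, G.edge (ρ i) (ρ (i + 1))) ∧ (∀ i, ρ i ∈ Y) ∧ infSet ρ = S := by
  obtain ⟨M⟩ := hY.exists_machine
  choose f hf using fun q => M.exists_step q (fun h => h)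
  obtain ⟨q, rfl⟩ := M.exists_state v hv
  have hs : ∀ i, M.step (f^[i] q) (f^[i + 1] q) := fun i => by
    rw [Function.iterate_succ_apply']
    exact hf _
  exact ⟨fun i => M.pos (f^[i] q), rfl, fun i => M.edge_of_step _ _ (hs i),
    fun i => M.pos_mem _, M.wins _ hs⟩

theorem exists_winsAll_of_play [Finite V] {ρ : ℕ → V} (hρ : ρ ∈ G.Play) :
    ∃ Y ⊆ Set.range ρ, G.init ∈ Y ∧ WinsAll G.edge Set.univ {infSet ρ} Y := by
  have hU : IsSubarena G.edge (Set.range ρ) := by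
    rintro _ ⟨i, rfl⟩
    exact ⟨_, ⟨i + 1, rfl⟩, hρ.2 i⟩
  obtain ⟨Y, h1, h2, h3, h4⟩ := exists_isPartition Set.univ {infSet ρ} hU
  refine ⟨Y, h1.subset, by_contra fun hY => ?_, h2⟩
  have hmem : ∀ i, ρ i ∈ Set.range ρ \ Y := fun i => by
    induction i with
    | zero => exact ⟨⟨0, rfl⟩, by rw [hρ.1]; exact hY⟩
    | succ i ih => exact (h3 _ ih).2.1 trivial _ ⟨i + 1, rfl⟩ (hρ.2 i)
  obtain ⟨M⟩ := h4.exists_machine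
  have hstep : ∀ i (q : {q // M.pos q = ρ i}), ∃ q' : {q // M.pos q = ρ (i + 1)},
      M.step q.1 q'.1 := fun i q => by
    obtain ⟨q', h, e⟩ := M.exists_step_to q.1 (ρ (i + 1)) (fun h => h) (fun h => h trivial)
      (hmem _) (by rw [q.2]; exact hρ.2 i)
    exact ⟨⟨q', e⟩, h⟩
  choose f hf using hstep
  obtain ⟨q₀, hq₀⟩ := M.exists_state _ (hmem 0)
  let s : ∀ i, {q // M.pos q = ρ i} := fun i => Nat.rec ⟨q₀, hq₀⟩ f i
  exact M.wins_of_eventually ρ 0 (fun i => (s i).1) (fun i => hf i (s i))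
    (fun i => by rw [zero_add]; exact (s i).2.symm) rfl

/-- If no deviation of `p` escapes the set `T`, then the coalition of the others wins from wherever
`p` can move. -/
theorem exists_region_of_follows [Finite V] {σ : G.Profile} {p : P} {T : Set (Set V)}
    (h : ∀ ρ, Follows σ {v | G.owner v ≠ p} ρ → infSet ρ ∈ T) :
    ∃ X : Set V, IsTrap G.edge {v | G.owner v = p} Set.univ X ∧
      WinsAll G.edge {v | G.owner v = p}ᶜ T X ∧
      ∀ i, G.owner (G.out σ i) = p → ∀ w, G.edge (G.out σ i) w → w ∈ X := by
  obtain ⟨X, h1, h2, Y, h3, h4, h5⟩ := exists_isPartition_reachable G {v | G.owner v = p}ᶜ T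
  rw [compl_compl] at h1
  refine ⟨X, h1, h2, fun i hi w hw => by_contra fun hX => ?_⟩
  have hρ := out_mem_play σ
  have hY := h5 w ((reachable_of_play hρ i).tail hw) hX
  obtain ⟨M⟩ := h4.exists_machine
  obtain ⟨ρ, hρ', n, e, -, hT, hf⟩ := exists_play_of_machine σ M
    (by rw [compl_compl]; exact h3) ((isHist_of_play hρ i).snoc hw) hY
  obtain rfl : i + 1 = n := by simpa using congrArg List.length e
  have hlt : ∀ j < i + 1, G.out σ j = ρ j := fun j hj => by
    have e' : (List.range (i + 1)).map (G.out σ) = (List.range (i + 1)).map ρ := by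
      rw [← e, List.range_succ, List.map_append]; rfl
    simpa [hj] using congrArg (fun l => l[j]?) e'
  refine hT (h ρ ⟨hρ', fun k hk => ?_⟩)
  rcases lt_trichotomy k i with hki | rfl | hki
  · rw [← hlt (k + 1) (by omega), (follows_out σ).2 k trivial]
    exact move_congr σ _ _ (range_map_congr fun j hj => hlt j (by omega)) (hlt k (by omega))
  · rw [Set.mem_ofPred, ← hlt k (by omega)] at hk
    exact absurd hi hk
  · exact hf k hki (by rw [compl_compl]; exact hk)

/-- The existence of a profile all of whose deviations are tolerated, in terms of certificates. -/
theorem exists_profile_iff_hasCertificate [Finite V] (F : P → Set (Set V)) (knw : Knowledge) :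
    (∃ σ : G.Profile, ∀ p ρ, Follows σ {v | G.owner v ≠ p} ρ → infSet ρ ∈
        tolerated G.edge {v | G.owner v = p} (F p) G.init knw (infSet (G.out σ))) ↔
      HasCertificate G.edge (fun p => {v | G.owner v = p}) F G.init knw := by
  constructor
  · rintro ⟨σ, h⟩
    obtain ⟨Y, hYr, hY, hw⟩ := exists_winsAll_of_play (out_mem_play σ)
    refine ⟨infSet (G.out σ), Y, hY, hw, fun p => ?_⟩
    obtain ⟨X, h1, h2, h3⟩ := exists_region_of_follows (h p)
    refine ⟨X, h1, h2, fun v hv hp w he => ?_⟩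
    obtain ⟨i, rfl⟩ := hYr hv
    exact h3 i hp w he
  · rintro ⟨S, Y, hY, hw, h⟩
    obtain ⟨ρ, h0, hρ, hρY, rfl⟩ := exists_path_of_winsAll hY hw
    choose X hX1 hX2 hX3 using h
    obtain ⟨σ, hσ, hσ'⟩ := exists_profile_of_machines ⟨h0, hρ⟩ (fun p => self_mem_tolerated) X
      (fun p => (hX2 p).exists_machine.some) hX1 fun i w he => hX3 _ _ (hρY i) rfl w he
    exact ⟨σ, by rw [hσ]; exact hσ'⟩

/-! ### Candidate objectives -/

theorem out_mem_muller {σ : G.Profile} {F : Set (Set V)} :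
    G.out σ ∈ G.muller F ↔ infSet (G.out σ) ∈ F :=
  ⟨fun h => h.2, fun h => ⟨out_mem_play σ, h⟩⟩

theorem winnable_mono {p : P} {F F' : Set (Set V)} (h : F ⊆ F') (hF : G.muller F ∈ G.Winnable p) :
    G.muller F' ∈ G.Winnable p := by
  obtain ⟨τ, hτ⟩ := hF
  exact ⟨τ, fun ρ hρ => ⟨(hτ hρ).1, h (hτ hρ).2⟩⟩

theorem muller_univ_mem_winnable (σ : G.Profile) (p : P) : G.muller Set.univ ∈ G.Winnable p :=
  ⟨σ p, fun _ hρ => ⟨hρ.1, trivial⟩⟩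

theorem muller_empty_not_mem_winnable (σ : G.Profile) (p : P) : G.muller ∅ ∉ G.Winnable p := by
  classical
  rintro ⟨τ, hτ⟩
  have h : G.out (Function.update σ p τ) ∈ G.outOf τ := by
    have := (mem_outOf_iff (σ := Function.update σ p τ) (p := p)).2
      ⟨out_mem_play _, fun i _ => (follows_out (Function.update σ p τ)).2 i trivial⟩
    rwa [Function.update_self] at this
  exact (hτ h).2

/-- If `O ↦ (t ∈ O ↔ a)` implies `O ↦ (s ∈ O ↔ b)`, then `t = s`, since otherwise some set `O`
decides the memberships of `t` and `s` independently. -/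
theorem eq_of_forall_separating {X : Type} {s t : X} {a b : Prop}
    (h : ∀ O : Set X, (t ∈ O ∧ a) ∨ (t ∉ O ∧ ¬a) → (s ∈ O ∧ b) ∨ (s ∉ O ∧ ¬b)) : t = s := by
  by_contra hne
  by_cases ha : a <;> by_cases hb : b
  · replace h := h {t}; simp_all [eq_comm]
  · replace h := h Set.univ; simp_all
  · replace h := h ∅; simp_all
  · replace h := h {s}; simp_all

/-- The inclusion between sets of candidate objectives depends only on the sets of vertices that
the two outcomes visit infinitely often. If these are `S` and `T`, then an inclusion that fails is
refuted by one of the Muller conditions `{S}`, `{S}ᶜ`, `{T}`, `∅` and `Set.univ`. -/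
theorem obj_subset_iff [Finite V] {F : P → Set (Set V)} {knw : Knowledge}
    {Ω' : Set (Set (ℕ → V))} (hΩ : knw = .pw → Ω' = Set.range mullerWords) {p : P}
    {σ σ' : G.Profile} :
    G.Obj G.mullerClass Ω' (fun p => G.muller (F p)) p σ' knw ⊆
        G.Obj G.mullerClass Ω' (fun p => G.muller (F p)) p σ knw ↔
      infSet (G.out σ') ∈
        tolerated G.edge {v | G.owner v = p} (F p) G.init knw (infSet (G.out σ)) := by
  have hwin : ∀ σ : G.Profile, p ∈ G.Win σ (fun p => G.muller (F p)) ↔ infSet (G.out σ) ∈ F p :=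
    fun σ => out_mem_muller
  generalize hS : infSet (G.out σ) = S
  generalize hT : infSet (G.out σ') = T
  have hWσ := hwin σ
  have hWσ' := hwin σ'
  rw [hS] at hWσ
  rw [hT] at hWσ'
  have hmσ : ∀ K, G.out σ ∈ G.muller K ↔ S ∈ K := fun K => by rw [out_mem_muller, hS]
  have hmσ' : ∀ K, G.out σ' ∈ G.muller K ↔ T ∈ K := fun K => by rw [out_mem_muller, hT]
  cases knw with
  | pw =>
    obtain rfl := hΩ rfl
    have h1 : ∀ K, G.out σ ∈ mullerWords K ↔ S ∈ K := fun K => by rw [← hS]; rfl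
    have h2 : ∀ K, G.out σ' ∈ mullerWords K ↔ T ∈ K := fun K => by rw [← hT]; rfl
    simp only [Obj, Set.ofPred_subset_ofPred, and_imp, Set.forall_mem_range, Set.mem_range_self,
      true_and, tolerated, Set.mem_ofPred, or_false, hWσ, hWσ', h1, h2]
    constructor
    · exact eq_of_forall_separating
    · rintro rfl K h
      exact h
  | gw =>
    have hne : G.muller Set.univ ≠ ∅ := fun h => by
      have : G.out σ ∈ G.muller Set.univ := (hmσ _).2 trivial
      rw [h] at this
      exact this
    have hem : G.muller ∅ = ∅ := Set.eq_empty_of_forall_notMem fun ρ h => h.2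
    have h1 := muller_univ_mem_winnable σ p
    have h2 := muller_empty_not_mem_winnable σ p
    simp only [Obj, Set.ofPred_subset_ofPred, and_imp, mullerClass, Set.forall_mem_range,
      Set.mem_range_self, true_and, tolerated, Set.mem_ofPred, hWσ, hWσ']
    constructor
    · intro h
      right
      by_cases hTp : T ∈ F p <;> by_cases hSp : S ∈ F p
      · exact iff_of_true hTp hSp
      · replace h := h Set.univ; simp_all
      · replace h := h ∅; simp_all
      · exact iff_of_false hTp hSp
    · rintro h K hK
      have hTS : T ∈ F p ↔ S ∈ F p := h.elim (fun h => by rw [h]) id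
      rwa [hTS] at hK
  | pg =>
    simp only [Obj, Set.ofPred_subset_ofPred, and_imp, mullerClass, Set.forall_mem_range,
      Set.mem_range_self, true_and, tolerated, Set.mem_ofPred, hmσ, hmσ',
      ← muller_mem_winnable_iff]
    constructor
    · intro h
      by_contra hc
      push Not at hc
      rcases h {S}ᶜ (.inl hc.1) with h | h
      · exact h rfl
      · exact h.2 hc.2
    · rintro (rfl | h) K hK
      · exact hK
      · by_cases hSK : S ∈ K
        · exact .inl hSK
        · exact .inr ⟨hSK, fun hw => h (winnable_mono (fun x hx => by rintro rfl; exact hSK hx) hw)⟩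
  | pgw =>
    have h1 := muller_univ_mem_winnable σ p
    have h2 := muller_empty_not_mem_winnable σ p
    simp only [Obj, Set.ofPred_subset_ofPred, and_imp, mullerClass, Set.forall_mem_range,
      Set.mem_range_self, true_and, tolerated, Set.mem_ofPred, hWσ, hWσ', hmσ, hmσ',
      ← muller_mem_winnable_iff]
    constructor
    · intro h
      by_contra hc
      by_cases hTp : T ∈ F p <;> by_cases hSp : S ∈ F p
      · replace h := h {T}; simp_all [eq_comm]
      · replace h := h Set.univ; simp_all
      · replace h := h ∅; simp_all
      · replace h := h {S}; simp_all
    · rintro (rfl | ⟨hSp, hTp, hw⟩) K hK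
      · exact hK
      · obtain ⟨hTK, -, hK⟩ := hK.resolve_left fun h => hTp h.2
        exact .inr ⟨fun hSK => hK (winnable_mono (Set.singleton_subset_iff.2 hSK) hw), hSp, hK⟩

theorem exists_isOIE_iff [Finite V] {F : P → Set (Set V)} {knw : Knowledge}
    {Ω' : Set (Set (ℕ → V))} (hΩ : knw = .pw → Ω' = Set.range mullerWords) :
    (∃ σ : G.Profile, G.IsOIE G.mullerClass Ω' knw (fun p => G.muller (F p)) σ) ↔
      HasCertificate G.edge (fun p => {v | G.owner v = p}) F G.init knw := by
  rw [← exists_profile_iff_hasCertificate]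
  refine exists_congr fun σ => forall_congr' fun p => ?_
  simp only [obj_subset_iff hΩ, ← exists_out_update_iff, forall_exists_index,
    forall_apply_eq_imp_iff]

/-- If arbitrary sets of words are candidate objectives and the adversary sees the play and the
winners, then equilibrium means that nobody can change the outcome, that is, there is only one
play. -/
theorem exists_isOIE_pw_univ_iff (Ω : Set (Set (ℕ → V))) (α : P → Set (ℕ → V)) :
    (∃ σ : G.Profile, G.IsOIE Ω Set.univ .pw α σ) ↔ IsDeterministic G.edge G.init := by
  classical
  constructor
  · rintro ⟨σ, h⟩
    have key : ∀ p τ, G.out (Function.update σ p τ) = G.out σ := by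
      intro p τ
      have h := h p τ
      simp only [Obj, Set.ofPred_subset_ofPred, Set.mem_univ, true_and] at h
      exact eq_of_forall_separating h
    have huniq : ∀ i w, G.edge (G.out σ i) w → w = G.out σ (i + 1) := by
      intro i w hw
      -- the owner of the vertex at time `i` deviates to `w`
      let τ := G.strategyOf (fun h v => if h.length = i then w else G.out σ (h.length + 1))
        (G.owner (G.out σ i))
      have hf := follows_out (Function.update σ _ τ)
      rw [key] at hf
      obtain ⟨hρ, hf⟩ := hf
      rw [hf i trivial, ← next_eq_move _ _ rfl, Function.update_self, strategyOf_next]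
      · simp
      · simpa using hw
    refine ⟨Set.range (G.out σ), ⟨0, rfl⟩, ?_⟩
    rintro _ ⟨i, rfl⟩
    refine ⟨fun w hw => ⟨i + 1, (huniq i w hw).symm⟩, fun w w' hw hw' => ?_⟩
    rw [huniq i w hw, huniq i w' hw']
  · rintro ⟨Y, h0, hY⟩
    have hmem : ∀ ρ ∈ G.Play, ∀ i, ρ i ∈ Y := fun ρ hρ i => by
      induction i with
      | zero => rw [hρ.1]; exact h0
      | succ i ih => exact (hY _ ih).1 _ (hρ.2 i)
    have huniq : ∀ ρ ∈ G.Play, ∀ ρ' ∈ G.Play, ρ = ρ' := fun ρ hρ ρ' hρ' => funext fun i => by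
      induction i with
      | zero => rw [hρ.1, hρ'.1]
      | succ i ih =>
        refine (hY _ (hmem ρ hρ i)).2 _ _ (hρ.2 i) ?_
        rw [ih]
        exact hρ'.2 i
    let σ : G.Profile := fun p => G.strategyOf (fun _ v => v) p
    refine ⟨σ, fun p τ => ?_⟩
    have := huniq _ (out_mem_play (Function.update σ p τ)) _ (out_mem_play σ)
    simp only [Obj, Win, this]
    exact subset_rfl

end Arena

/-! ### Primitive recursive quantification over finite sets and families -/

theorem PrimrecRel.weaken {α β γ : Type*} [Primcodable α] [Primcodable β] [Primcodable γ]
    {R : α → γ → Prop} (hR : PrimrecRel R) {f : β → α} (hf : Primrec f) :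
    PrimrecRel fun b x => R (f b) x :=
  hR.comp (hf.comp .fst) .snd

theorem PrimrecPred.imp {α : Type*} [Primcodable α] {p q : α → Prop} (hp : PrimrecPred p)
    (hq : PrimrecPred q) : PrimrecPred fun a => p a → q a :=
  (hp.not.or hq).of_eq fun _ => imp_iff_not_or.symm

theorem PrimrecPred.iff {α : Type*} [Primcodable α] {p q : α → Prop} (hp : PrimrecPred p)
    (hq : PrimrecPred q) : PrimrecPred fun a => p a ↔ q a :=
  ((hp.imp hq).and (hq.imp hp)).of_eq fun _ => iff_iff_implies_and_implies.symm

theorem primrecPred_const {α : Type*} [Primcodable α] (p : Prop) :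
    PrimrecPred fun _ : α => p := by
  classical
  exact ⟨fun _ => inferInstance, Primrec.const (decide p)⟩

section Decoding

/-- The subset of `Fin n` cut out by a property of numbers. -/
def sub (n : ℕ) (B : ℕ → Prop) : Set (Fin n) := {v | B v}

/-- The relation on `Fin n` given by a property of pairs of numbers. -/
def rel (n : ℕ) (E : ℕ × ℕ → Prop) : Fin n → Fin n → Prop := fun v w => E (v, w)

/-- The set of numbers whose binary digits are ones in `x`. -/
def bits (x i : ℕ) : Prop := x.testBit i = true

/-- The family of subsets of `Fin n` whose codes are ones in the binary expansion of `t`. -/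
def fam (n t : ℕ) : Set (Set (Fin n)) := {s | ∃ x < 2 ^ n, sub n (bits x) = s ∧ bits t x}

theorem exists_bits (n : ℕ) (B : ℕ → Prop) : ∃ x < 2 ^ n, ∀ i < n, bits x i ↔ B i := by
  classical
  refine ⟨Nat.ofBits fun i : Fin n => decide (B i), Nat.ofBits_lt_two_pow _, fun i hi => ?_⟩
  rw [bits, Nat.testBit_ofBits_lt _ _ hi, decide_eq_true_iff]

theorem exists_sub_bits {n : ℕ} (s : Set (Fin n)) : ∃ x < 2 ^ n, sub n (bits x) = s := by
  obtain ⟨x, hx, h⟩ := exists_bits n fun i => ∃ h : i < n, ⟨i, h⟩ ∈ s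
  exact ⟨x, hx, Set.ext fun v => (h v v.2).trans ⟨fun h => h.2, fun h => ⟨v.2, h⟩⟩⟩

theorem exists_fam {n : ℕ} (C : Set (Set (Fin n))) : ∃ t < 2 ^ 2 ^ n, fam n t = C := by
  obtain ⟨t, ht, h⟩ := exists_bits (2 ^ n) fun x => sub n (bits x) ∈ C
  refine ⟨t, ht, Set.ext fun s => ⟨?_, fun hs => ?_⟩⟩
  · rintro ⟨x, hx, rfl, hb⟩
    exact (h x hx).1 hb
  · obtain ⟨x, hx, rfl⟩ := exists_sub_bits s
    exact ⟨x, hx, rfl, (h x hx).2 hs⟩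

theorem sub_eq_sub {n : ℕ} {B C : ℕ → Prop} : sub n B = sub n C ↔ ∀ i < n, (B i ↔ C i) :=
  ⟨fun h i hi => Set.ext_iff.1 h ⟨i, hi⟩, fun h => Set.ext fun v => h v v.2⟩

theorem singleton_eq_sub {n : ℕ} (v : Fin n) : {v} = sub n fun i => i = v :=
  Set.ext fun _ => Fin.ext_iff

end Decoding

section Quantifiers

variable {α : Type} [Primcodable α] {n : α → ℕ}

theorem primrec_two_pow (hn : Primrec n) : Primrec fun a => 2 ^ n a :=
  (Primrec₂.unpaired'.1 Nat.Primrec.pow).comp (.const 2) hn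

theorem primrecRel_bits : PrimrecRel bits := by
  have : PrimrecPred fun q : ℕ × ℕ => q.1 / 2 ^ q.2 % 2 = 1 :=
    Primrec.eq.comp (Primrec.nat_mod.comp
      (Primrec.nat_div.comp .fst (primrec_two_pow .snd)) (.const 2)) (.const 1)
  exact this.of_eq fun q => by rw [bits, Nat.testBit_eq_decide_div_mod_eq, decide_eq_true_iff]

theorem PrimrecRel.forall_lt_of {P : α → ℕ → Prop} (hP : PrimrecRel P) (hn : Primrec n) :
    PrimrecPred fun a => ∀ x < n a, P a x :=
  ((PrimrecRel.forall_mem_list (R := fun x a => P a x) (hP.comp .snd .fst)).comp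
    (Primrec.list_range.comp hn) .id).of_eq fun _ => by simp only [List.mem_range, id]

theorem PrimrecRel.exists_lt_of {P : α → ℕ → Prop} (hP : PrimrecRel P) (hn : Primrec n) :
    PrimrecPred fun a => ∃ x < n a, P a x :=
  ((PrimrecRel.exists_mem_list (R := fun x a => P a x) (hP.comp .snd .fst)).comp
    (Primrec.list_range.comp hn) .id).of_eq fun _ => by simp only [List.mem_range, id]

theorem PrimrecRel.forall_fin {P : α → ℕ → Prop} (hP : PrimrecRel P) (hn : Primrec n) :
    PrimrecPred fun a => ∀ v : Fin (n a), P a v :=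
  (hP.forall_lt_of hn).of_eq fun _ => ⟨fun h v => h v v.2, fun h v hv => h ⟨v, hv⟩⟩

theorem PrimrecRel.forall_mem_sub {P U : α → ℕ → Prop} (hP : PrimrecRel P) (hU : PrimrecRel U)
    (hn : Primrec n) : PrimrecPred fun a => ∀ v ∈ sub (n a) (U a), P a v :=
  PrimrecRel.forall_fin (P := fun a v => U a v → P a v) (PrimrecPred.imp hU hP) hn

theorem PrimrecRel.exists_mem_sub {P U : α → ℕ → Prop} (hP : PrimrecRel P) (hU : PrimrecRel U)
    (hn : Primrec n) : PrimrecPred fun a => ∃ v ∈ sub (n a) (U a), P a v :=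
  (PrimrecRel.exists_lt_of (P := fun a v => U a v ∧ P a v) (PrimrecPred.and hU hP) hn).of_eq
    fun _ => ⟨fun ⟨v, hv, h⟩ => ⟨⟨v, hv⟩, h⟩, fun ⟨v, h⟩ => ⟨v, v.2, h⟩⟩

theorem PrimrecRel.forall_set {P : ∀ a, Set (Fin (n a)) → Prop}
    (hP : PrimrecRel fun a x => P a (sub (n a) (bits x))) (hn : Primrec n) :
    PrimrecPred fun a => ∀ s, P a s :=
  (hP.forall_lt_of (primrec_two_pow hn)).of_eq fun _ =>
    ⟨fun h s => let ⟨x, hx, e⟩ := exists_sub_bits s; e ▸ h x hx, fun h _ _ => h _⟩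

theorem PrimrecRel.exists_set {P : ∀ a, Set (Fin (n a)) → Prop}
    (hP : PrimrecRel fun a x => P a (sub (n a) (bits x))) (hn : Primrec n) :
    PrimrecPred fun a => ∃ s, P a s :=
  (hP.exists_lt_of (primrec_two_pow hn)).of_eq fun _ =>
    ⟨fun ⟨_, _, h⟩ => ⟨_, h⟩, fun ⟨s, h⟩ =>
      let ⟨x, hx, e⟩ := exists_sub_bits s; ⟨x, hx, e.symm ▸ h⟩⟩

theorem PrimrecRel.forall_fam {P : ∀ a, Set (Set (Fin (n a))) → Prop}
    (hP : PrimrecRel fun a t => P a (fam (n a) t)) (hn : Primrec n) :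
    PrimrecPred fun a => ∀ C, P a C :=
  (hP.forall_lt_of (primrec_two_pow (primrec_two_pow hn))).of_eq fun _ =>
    ⟨fun h s => let ⟨x, hx, e⟩ := exists_fam s; e ▸ h x hx, fun h _ _ => h _⟩

theorem PrimrecRel.sub_eq_sub {B C : α → ℕ → Prop} (hB : PrimrecRel B) (hC : PrimrecRel C)
    (hn : Primrec n) : PrimrecPred fun a => sub (n a) (B a) = sub (n a) (C a) :=
  (PrimrecRel.forall_lt_of (P := fun a i => B a i ↔ C a i) (PrimrecPred.iff hB hC) hn).of_eq
    fun _ => _root_.sub_eq_sub.symm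

theorem primrec_mem_fam (hn : Primrec n) {B : α → ℕ → Prop} (hB : PrimrecRel B) {t : α → ℕ}
    (ht : Primrec t) : PrimrecPred fun a => sub (n a) (B a) ∈ fam (n a) (t a) := by
  refine PrimrecRel.exists_lt_of (PrimrecPred.and (p := fun q : α × ℕ =>
    sub (n q.1) (bits q.2) = sub (n q.1) (B q.1)) ?_ ?_) (primrec_two_pow hn)
  · exact PrimrecRel.sub_eq_sub (n := fun q : α × ℕ => n q.1) (B := fun q => bits q.2)
      (primrecRel_bits.weaken .snd) (hB.weaken .fst) (hn.comp .fst)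
  · exact primrecRel_bits.comp (ht.comp .fst) .snd

end Quantifiers

/-! ### Primitive recursiveness of the certificates -/

section Certificates

variable {α : Type} [Primcodable α] {n : α → ℕ} (hn : Primrec n)
  {E : α → ℕ × ℕ → Prop} (hE : PrimrecRel E)

include hn hE

theorem primrec_isSubarena {U : α → ℕ → Prop} (hU : PrimrecRel U) :
    PrimrecPred fun a => IsSubarena (rel (n a) (E a)) (sub (n a) (U a)) :=
  PrimrecRel.forall_mem_sub (P := fun a v => ∃ w ∈ sub (n a) (U a), E a (v, w))
    (PrimrecRel.exists_mem_sub (P := fun (q : α × ℕ) w => E q.1 (q.2, w))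
      (hE.comp (Primrec.fst.comp .fst) ((Primrec.snd.comp .fst).pair .snd))
      (hU.weaken .fst) (hn.comp .fst)) hU hn

theorem primrec_isTrap {A U B : α → ℕ → Prop} (hA : PrimrecRel A) (hU : PrimrecRel U)
    (hB : PrimrecRel B) : PrimrecPred fun a =>
      IsTrap (rel (n a) (E a)) (sub (n a) (A a)) (sub (n a) (U a)) (sub (n a) (B a)) := by
  have hE' : PrimrecRel fun (q : α × ℕ) w => E q.1 (q.2, w) :=
    hE.comp (Primrec.fst.comp .fst) ((Primrec.snd.comp .fst).pair .snd)
  exact PrimrecRel.forall_mem_sub (P := fun a v => U a v ∧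
      (A a v → ∀ w ∈ sub (n a) (U a), E a (v, w) → B a w) ∧ ∃ w ∈ sub (n a) (B a), E a (v, w))
    (PrimrecPred.and hU ((PrimrecPred.imp hA (PrimrecRel.forall_mem_sub
      (P := fun (q : α × ℕ) w => E q.1 (q.2, w) → B q.1 w)
        (PrimrecPred.imp hE' (hB.weaken .fst)) (hU.weaken .fst) (hn.comp .fst))).and
      (PrimrecRel.exists_mem_sub (P := fun (q : α × ℕ) w => E q.1 (q.2, w)) hE'
        (hB.weaken .fst) (hn.comp .fst)))) hB hn

theorem primrec_isMaxTrap {A U X Z : α → ℕ → Prop} (hA : PrimrecRel A) (hU : PrimrecRel U)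
    (hX : PrimrecRel X) (hZ : PrimrecRel Z) : PrimrecPred fun a =>
      IsMaxTrap (rel (n a) (E a)) (sub (n a) (A a)) (sub (n a) (U a)) (sub (n a) (X a))
        (sub (n a) (Z a)) := by
  refine (primrec_isTrap hn hE hA hU hZ).and ((PrimrecRel.forall_mem_sub
    (P := fun a v => ¬ X a v) hX.not hZ hn).and (PrimrecRel.forall_set ?_ hn))
  have hB : PrimrecRel fun q : α × ℕ => bits q.2 := primrecRel_bits.weaken .snd
  exact (primrec_isTrap (hn.comp .fst) (hE.weaken .fst) (hA.weaken .fst) (hU.weaken .fst) hB).imp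
    ((PrimrecRel.forall_mem_sub (P := fun (q : α × ℕ) v => ¬ X q.1 v) (hX.weaken .fst).not hB
      (hn.comp .fst)).imp
      (PrimrecRel.forall_mem_sub (P := fun (q : α × ℕ) v => Z q.1 v) (hZ.weaken .fst) hB
        (hn.comp .fst)))

theorem primrec_ruleClosed {A : α → ℕ → Prop} (hA : PrimrecRel A)
    {T : ∀ a, Set (Set (Fin (n a)))} (hT : PrimrecRel fun a x => sub (n a) (bits x) ∈ T a)
    {C : ∀ a, Set (Set (Fin (n a)))} (hC : PrimrecRel fun a x => sub (n a) (bits x) ∈ C a) :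
    PrimrecPred fun a => RuleClosed (rel (n a) (E a)) (sub (n a) (A a)) (T a) (C a) := by
  have hB {β : Type} [Primcodable β] {f : β → ℕ} (hf : Primrec f) :
      PrimrecRel fun b => bits (f b) := primrecRel_bits.weaken hf
  refine PrimrecPred.and ?_ (PrimrecPred.and (PrimrecRel.forall_set ?_ hn)
    (PrimrecRel.forall_set (PrimrecRel.forall_set (n := fun q : α × ℕ => n q.1)
      (PrimrecRel.forall_set (n := fun q : (α × ℕ) × ℕ => n q.1.1) ?_ ?_) ?_) hn))
  · refine (hC.comp .id (.const 0)).of_eq fun a => ?_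
    have e : sub (n a) (bits 0) = ∅ := Set.ext fun v => by simp [sub, bits]
    rw [id, e]
  · refine (primrec_isSubarena (hn.comp .fst) (hE.weaken .fst) (hB .snd)).imp
      (PrimrecPred.imp hT (PrimrecPred.imp ?_ hC))
    simp only [singleton_eq_sub]
    refine PrimrecRel.forall_mem_sub (n := fun q : α × ℕ => n q.1) (P := fun q v => ∃ Z, Z ∈ C q.1 ∧
      IsMaxTrap (rel (n q.1) (E q.1)) (sub (n q.1) (A q.1)) (sub (n q.1) (bits q.2))
        (sub (n q.1) fun i => i = v) Z) ?_ (hB .snd) (hn.comp .fst)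
    refine PrimrecRel.exists_set (n := fun q : (α × ℕ) × ℕ => n q.1.1) ?_
      (hn.comp (Primrec.fst.comp .fst))
    have h1 : Primrec fun q : ((α × ℕ) × ℕ) × ℕ => q.1.1.1 :=
      Primrec.fst.comp (Primrec.fst.comp .fst)
    exact (hC.comp h1 .snd).and (primrec_isMaxTrap (hn.comp h1) (hE.weaken h1) (hA.weaken h1)
      (hB (Primrec.snd.comp (Primrec.fst.comp .fst)))
      (Primrec.eq.comp .snd (Primrec.snd.comp (Primrec.fst.comp .fst))) (hB .snd))
  · have h1 : Primrec fun q : ((α × ℕ) × ℕ) × ℕ => q.1.1.1 :=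
      Primrec.fst.comp (Primrec.fst.comp .fst)
    have hu : Primrec fun q : ((α × ℕ) × ℕ) × ℕ => q.1.1.2 :=
      Primrec.snd.comp (Primrec.fst.comp .fst)
    have hx : Primrec fun q : ((α × ℕ) × ℕ) × ℕ => q.1.2 := Primrec.snd.comp .fst
    exact (primrec_isSubarena (hn.comp h1) (hE.weaken h1) (hB hu)).imp
      ((hC.comp h1 hx).imp ((hC.comp h1 .snd).imp
        ((primrec_isTrap (hn.comp h1) (hE.weaken h1) (hA.weaken h1).not (hB hu) (hB hx)).imp
          ((primrec_isMaxTrap (hn.comp h1) (hE.weaken h1) (hA.weaken h1) (hB hu) (hB hx)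
            (hB .snd)).imp (hC.comp h1 hu)))))
  · exact hn.comp (Primrec.fst.comp .fst)
  · exact hn.comp .fst

theorem primrec_winsAll {A U : α → ℕ → Prop} (hA : PrimrecRel A) (hU : PrimrecRel U)
    {T : ∀ a, Set (Set (Fin (n a)))} (hT : PrimrecRel fun a x => sub (n a) (bits x) ∈ T a) :
    PrimrecPred fun a => WinsAll (rel (n a) (E a)) (sub (n a) (A a)) (T a) (sub (n a) (U a)) := by
  refine PrimrecRel.forall_fam (PrimrecPred.imp ?_ ?_) hn
  · exact primrec_ruleClosed (hn.comp .fst) (hE.weaken .fst) (hA.weaken .fst)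
      (T := fun q => T q.1) (hT.weaken .fst)
      (primrec_mem_fam (hn.comp (Primrec.fst.comp .fst)) (primrecRel_bits.weaken .snd)
        (Primrec.snd.comp .fst))
  · exact primrec_mem_fam (hn.comp .fst) (hU.weaken .fst) .snd

theorem primrec_canForce {A : α → ℕ → Prop} (hA : PrimrecRel A)
    {T : ∀ a, Set (Set (Fin (n a)))} (hT : PrimrecRel fun a x => sub (n a) (bits x) ∈ T a)
    {v₀ : ∀ a, Fin (n a)} (hv : Primrec fun a => (v₀ a : ℕ)) :
    PrimrecPred fun a => CanForce (rel (n a) (E a)) (sub (n a) (A a)) (T a) (v₀ a) := by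
  have hX : PrimrecRel fun q : α × ℕ => bits q.2 := primrecRel_bits.weaken .snd
  refine PrimrecRel.exists_set (PrimrecPred.and ?_ (PrimrecPred.and ?_ ?_)) hn
  · exact primrecRel_bits.comp .snd (hv.comp .fst)
  · exact primrec_isTrap (hn.comp .fst) (hE.weaken .fst) (hA.weaken .fst).not
      (U := fun _ _ => True) (primrecPred_const True) hX
  · exact primrec_winsAll (hn.comp .fst) (hE.weaken .fst) (hA.weaken .fst) hX (hT.weaken .fst)

theorem primrec_mem_tolerated {A : α → ℕ → Prop} (hA : PrimrecRel A)
    {F : ∀ a, Set (Set (Fin (n a)))} (hF : PrimrecRel fun a x => sub (n a) (bits x) ∈ F a)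
    {v₀ : ∀ a, Fin (n a)} (hv : Primrec fun a => (v₀ a : ℕ)) (knw : Knowledge) {s : α → ℕ}
    (hs : Primrec s) : PrimrecRel fun a x => sub (n a) (bits x) ∈
      tolerated (rel (n a) (E a)) (sub (n a) (A a)) (F a) (v₀ a) knw (sub (n a) (bits (s a))) := by
  have hsing : PrimrecRel fun a x => sub (n a) (bits x) = sub (n a) (bits (s a)) :=
    PrimrecRel.sub_eq_sub (n := fun q : α × ℕ => n q.1) (B := fun q => bits q.2)
      (primrecRel_bits.weaken .snd) (primrecRel_bits.weaken (hs.comp .fst)) (hn.comp .fst)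
  refine PrimrecPred.or hsing ?_
  cases knw with
  | pw => exact primrecPred_const False
  | gw => exact PrimrecPred.iff hF (hF.comp .fst (hs.comp .fst))
  | pg =>
    exact (primrec_canForce hn hE hA (T := fun a => {sub (n a) (bits (s a))}ᶜ) hsing.not
      hv).not.comp .fst
  | pgw =>
    exact (hF.comp .fst (hs.comp .fst)).not.and ((PrimrecPred.not hF).and
      ((primrec_canForce hn hE hA (T := fun a => {sub (n a) (bits (s a))}) hsing hv).comp .fst))

theorem primrec_isConfined {A : α → ℕ → Prop} (hA : PrimrecRel A)
    {F : ∀ a, Set (Set (Fin (n a)))} (hF : PrimrecRel fun a x => sub (n a) (bits x) ∈ F a)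
    {v₀ : ∀ a, Fin (n a)} (hv : Primrec fun a => (v₀ a : ℕ)) (knw : Knowledge) {s y : α → ℕ}
    (hs : Primrec s) (hy : Primrec y) : PrimrecPred fun a =>
      IsConfined (rel (n a) (E a)) (sub (n a) (A a)) (F a) (v₀ a) knw (sub (n a) (bits (s a)))
        (sub (n a) (bits (y a))) := by
  have hX : PrimrecRel fun q : α × ℕ => bits q.2 := primrecRel_bits.weaken .snd
  refine PrimrecRel.exists_set (PrimrecPred.and ?_ (PrimrecPred.and ?_ ?_)) hn
  · exact primrec_isTrap (hn.comp .fst) (hE.weaken .fst) (hA.weaken .fst)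
      (U := fun _ _ => True) (primrecPred_const True) hX
  · exact primrec_winsAll (hn.comp .fst) (hE.weaken .fst) (hA.weaken .fst).not hX
      ((primrec_mem_tolerated hn hE hA hF hv knw hs).weaken .fst)
  · refine PrimrecRel.forall_mem_sub (n := fun q : α × ℕ => n q.1)
      (P := fun q v => A q.1 v → ∀ w : Fin (n q.1), E q.1 (v, w) → bits q.2 w)
      (PrimrecPred.imp (hA.comp (Primrec.fst.comp .fst) .snd) ?_)
      (primrecRel_bits.weaken (hy.comp .fst)) (hn.comp .fst)
    exact PrimrecRel.forall_fin (n := fun q : (α × ℕ) × ℕ => n q.1.1)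
      (P := fun q w => E q.1.1 (q.2, w) → bits q.1.2 w) (PrimrecPred.imp
        (hE.comp (Primrec.fst.comp (Primrec.fst.comp .fst)) ((Primrec.snd.comp .fst).pair .snd))
        (primrecRel_bits.comp (Primrec.snd.comp (Primrec.fst.comp .fst)) .snd))
      (hn.comp (Primrec.fst.comp .fst))

theorem primrec_hasCertificate {m : α → ℕ} (hm : Primrec m) {own : α → ℕ → ℕ → Prop}
    (hown : PrimrecRel fun (q : α × ℕ) v => own q.1 q.2 v)
    {F : ∀ a, ℕ → Set (Set (Fin (n a)))}
    (hF : PrimrecRel fun (q : α × ℕ) x => sub (n q.1) (bits x) ∈ F q.1 q.2)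
    {v₀ : ∀ a, Fin (n a)} (hv : Primrec fun a => (v₀ a : ℕ)) (knw : Knowledge) :
    PrimrecPred fun a => HasCertificate (rel (n a) (E a))
      (fun p : Fin (m a) => sub (n a) (own a p)) (fun p => F a p) (v₀ a) knw := by
  have h1 : Primrec fun q : (α × ℕ) × ℕ => q.1.1 := Primrec.fst.comp .fst
  refine PrimrecRel.exists_set (PrimrecRel.exists_set (n := fun q : α × ℕ => n q.1)
    (PrimrecPred.and ?_ (PrimrecPred.and ?_ ?_)) (hn.comp .fst)) hn
  · exact primrecRel_bits.comp .snd (hv.comp h1)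
  · refine primrec_winsAll (hn.comp h1) (hE.weaken h1) (A := fun _ _ => True)
      (primrecPred_const True) (primrecRel_bits.weaken .snd) ?_
    exact PrimrecRel.sub_eq_sub (n := fun q : ((α × ℕ) × ℕ) × ℕ => n q.1.1.1)
      (B := fun q => bits q.2) (C := fun q => bits q.1.1.2) (primrecRel_bits.weaken .snd)
      (primrecRel_bits.weaken (Primrec.snd.comp (Primrec.fst.comp .fst)))
      (hn.comp (h1.comp .fst))
  · have h2 : Primrec fun q : ((α × ℕ) × ℕ) × ℕ => q.1.1.1 := h1.comp .fst
    have h3 : Primrec fun q : ((α × ℕ) × ℕ) × ℕ => (q.1.1.1, q.2) := h2.pair .snd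
    exact PrimrecRel.forall_fin (n := fun q : (α × ℕ) × ℕ => m q.1.1)
      (P := fun q p => IsConfined (rel (n q.1.1) (E q.1.1)) (sub (n q.1.1) (own q.1.1 p))
        (F q.1.1 p) (v₀ q.1.1) knw (sub (n q.1.1) (bits q.1.2)) (sub (n q.1.1) (bits q.2)))
      (primrec_isConfined (hn.comp h2) (hE.weaken h2) (hown.weaken h3)
        (F := fun q => F q.1.1.1 q.2) (hF.weaken h3) (v₀ := fun q => v₀ q.1.1.1) (hv.comp h2)
        knw (Primrec.snd.comp (Primrec.fst.comp .fst)) (Primrec.snd.comp .fst)) (hm.comp h1)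

theorem primrec_isDeterministic {v₀ : ∀ a, Fin (n a)} (hv : Primrec fun a => (v₀ a : ℕ)) :
    PrimrecPred fun a => IsDeterministic (rel (n a) (E a)) (v₀ a) := by
  have hE' : PrimrecRel fun (q : (α × ℕ) × ℕ) w => E q.1.1 (q.2, w) :=
    hE.comp (Primrec.fst.comp (Primrec.fst.comp .fst)) ((Primrec.snd.comp .fst).pair .snd)
  have hn2 : Primrec fun q : (α × ℕ) × ℕ => n q.1.1 := hn.comp (Primrec.fst.comp .fst)
  refine PrimrecRel.exists_set (PrimrecPred.and ?_ ?_) hn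
  · exact primrecRel_bits.comp .snd (hv.comp .fst)
  · refine (PrimrecRel.forall_mem_sub (n := fun q : α × ℕ => n q.1) (U := fun q => bits q.2)
      (P := fun q v => (∀ w : Fin (n q.1), E q.1 (v, w) → bits q.2 w) ∧
        ∀ w : Fin (n q.1), ∀ w' : Fin (n q.1), E q.1 (v, w) → E q.1 (v, w') → (w : ℕ) = w')
      (PrimrecPred.and ?_ ?_) (primrecRel_bits.weaken .snd) (hn.comp .fst)).of_eq fun q => ?_
    · exact PrimrecRel.forall_fin (n := fun q : (α × ℕ) × ℕ => n q.1.1)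
        (P := fun q w => E q.1.1 (q.2, w) → bits q.1.2 w) (PrimrecPred.imp hE'
          (primrecRel_bits.comp (Primrec.snd.comp (Primrec.fst.comp .fst)) .snd)) hn2
    · refine PrimrecRel.forall_fin (n := fun q : (α × ℕ) × ℕ => n q.1.1)
        (P := fun q w => ∀ w' : Fin (n q.1.1), E q.1.1 (q.2, w) → E q.1.1 (q.2, w') →
          w = w') ?_ hn2
      exact PrimrecRel.forall_fin (n := fun q : ((α × ℕ) × ℕ) × ℕ => n q.1.1.1)
        (P := fun q w' => E q.1.1.1 (q.1.2, q.2) → E q.1.1.1 (q.1.2, w') → q.2 = w')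
        (PrimrecPred.imp (PrimrecPred.comp hE' .fst)
          (PrimrecPred.imp (hE'.comp (Primrec.fst.comp .fst) .snd)
            (Primrec.eq.comp (Primrec.snd.comp .fst) .snd))) (hn2.comp .fst)
    · simp only [← Fin.ext_iff]
      rfl

end Certificates

/-! ### Reading the codes of games -/

namespace GameCode

/-- The number of vertices; the arenas that have codes have at least one vertex, and reading `0`
as `1` makes the initial vertex meaningful for all codes. -/
def numVertices (c : GameCode) : ℕ := c.2.1 - 1 + 1

/-- The initial vertex. -/
def initial (c : GameCode) : Fin (numVertices c) :=
  ⟨c.2.2.1 % numVertices c, Nat.mod_lt _ (Nat.succ_pos _)⟩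

/-- The edges. -/
def edges (c : GameCode) (e : ℕ × ℕ) : Prop := e ∈ c.2.2.2.2.1

/-- Player `p` owns vertex `v`. -/
def owns (c : GameCode) (p v : ℕ) : Prop := c.2.2.2.1[v]? = some p

/-- The Muller condition of player `p`. -/
def family (c : GameCode) (p : ℕ) : Set (Set (Fin (numVertices c))) :=
  {S | ∃ l ∈ c.2.2.2.2.2.getD p [], S = sub (numVertices c) fun v => v ∈ l}

theorem primrec_numVertices : Primrec numVertices :=
  Primrec.succ.comp (Primrec.nat_sub.comp (Primrec.fst.comp .snd) (.const 1))

theorem primrec_initial : Primrec fun c => (initial c : ℕ) :=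
  Primrec.nat_mod.comp (Primrec.fst.comp (Primrec.snd.comp .snd)) primrec_numVertices

theorem primrecRel_mem_list {α : Type} [Primcodable α] :
    PrimrecRel fun (l : List α) a => a ∈ l :=
  (PrimrecRel.exists_mem_list Primrec.eq).of_eq fun l a => by simp

theorem primrecRel_edges : PrimrecRel edges :=
  primrecRel_mem_list.weaken
    (Primrec.fst.comp (Primrec.snd.comp (Primrec.snd.comp (Primrec.snd.comp .snd))))

theorem primrecRel_owns : PrimrecRel fun (q : GameCode × ℕ) v => owns q.1 q.2 v :=
  Primrec.eq.comp (Primrec.list_getElem?.comp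
    (Primrec.fst.comp (Primrec.snd.comp (Primrec.snd.comp
      (Primrec.snd.comp (Primrec.fst.comp .fst))))) .snd)
    (Primrec.option_some.comp (Primrec.snd.comp .fst))

theorem primrecRel_family : PrimrecRel fun (q : GameCode × ℕ) x =>
    sub (numVertices q.1) (bits x) ∈ family q.1 q.2 := by
  have h : PrimrecRel fun (l : List ℕ) (r : (GameCode × ℕ) × ℕ) =>
      sub (numVertices r.1.1) (bits r.2) = sub (numVertices r.1.1) fun v => v ∈ l :=
    PrimrecRel.sub_eq_sub (n := fun q : List ℕ × (GameCode × ℕ) × ℕ => numVertices q.2.1.1)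
      (B := fun q => bits q.2.2) (C := fun q v => v ∈ q.1)
      (primrecRel_bits.weaken (Primrec.snd.comp .snd)) (primrecRel_mem_list.weaken .fst)
      (primrec_numVertices.comp (Primrec.fst.comp (Primrec.fst.comp .snd)))
  refine (PrimrecRel.exists_mem_list h).comp (f := fun q => q.1.1.2.2.2.2.2.getD q.1.2 [])
    ?_ .id
  exact (Primrec.list_getD []).comp (Primrec.snd.comp (Primrec.snd.comp (Primrec.snd.comp
    (Primrec.snd.comp (Primrec.snd.comp (Primrec.fst.comp .fst)))))) (Primrec.snd.comp .fst)

end GameCode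

/-- The certificate condition for the game described by a code. -/
def CodeHasCertificate (knw : Knowledge) (c : GameCode) : Prop :=
  HasCertificate (rel c.numVertices c.edges)
    (fun p : Fin c.1 => sub c.numVertices (c.owns p)) (fun p => c.family p) c.initial knw

/-- The absence of branching in the arena described by a code. -/
def CodeIsDeterministic (c : GameCode) : Prop :=
  IsDeterministic (rel c.numVertices c.edges) c.initial

theorem computablePred_codeHasCertificate (knw : Knowledge) :
    ComputablePred (CodeHasCertificate knw) :=
  (primrec_hasCertificate GameCode.primrec_numVertices GameCode.primrecRel_edges
    (m := fun c : GameCode => c.1) .fst GameCode.primrecRel_owns GameCode.primrecRel_family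
    GameCode.primrec_initial knw).computablePred

theorem computablePred_codeIsDeterministic : ComputablePred CodeIsDeterministic :=
  (primrec_isDeterministic GameCode.primrec_numVertices GameCode.primrecRel_edges
    GameCode.primrec_initial).computablePred

theorem Encodes.conditions_iff {m n : ℕ} {G : Arena (Fin m) (Fin n)}
    {F : Fin m → Set (Set (Fin n))} {c : GameCode} (h : Encodes c G F) :
    (∀ knw, CodeHasCertificate knw c ↔
      HasCertificate G.edge (fun p => {v | G.owner v = p}) F G.init knw) ∧
    (CodeIsDeterministic c ↔ IsDeterministic G.edge G.init) := by
  obtain ⟨m', n', i, own, es, fs⟩ := c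
  obtain ⟨rfl, rfl, rfl, rfl, hes, -, hF⟩ := h
  obtain _ | n := n'
  · exact G.init.elim0
  -- `numVertices` of the code is now `n + 1` by definition
  have h1 : rel (n + 1) (fun e => e ∈ es) = G.edge := by
    funext v w
    refine propext ((hes v w).trans ⟨?_, fun h => ⟨v, w, rfl, rfl, h⟩⟩)
    rintro ⟨v', w', hv, hw, h⟩
    rwa [Fin.ext hv, Fin.ext hw] at h
  have h2 : (fun p : Fin m' => sub (n + 1) fun v =>
      (List.ofFn fun v => (G.owner v : ℕ))[v]? = some (p : ℕ)) =
        fun p => {v | G.owner v = p} := by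
    funext p
    ext v
    show (List.ofFn fun v => (G.owner v : ℕ))[(v : ℕ)]? = some (p : ℕ) ↔ G.owner v = p
    rw [List.getElem?_ofFn, dif_pos v.2, Option.some_inj, Fin.ext_iff]
  have h3 : (fun p : Fin m' => {S : Set (Fin (n + 1)) | ∃ l ∈ fs.getD p [],
      S = sub (n + 1) fun v => v ∈ l}) = F := by
    funext p
    ext S
    exact (hF p S).symm
  have h4 : (⟨G.init % (n + 1), Nat.mod_lt _ (Nat.succ_pos n)⟩ : Fin (n + 1)) = G.init :=
    Fin.ext (Nat.mod_eq_of_lt G.init.2)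
  constructor
  · intro knw
    change HasCertificate (rel (n + 1) fun e => e ∈ es)
      (fun p : Fin m' => sub (n + 1) fun v =>
        (List.ofFn fun v => (G.owner v : ℕ))[v]? = some (p : ℕ))
      (fun p : Fin m' => {S : Set (Fin (n + 1)) | ∃ l ∈ fs.getD p [],
        S = sub (n + 1) fun v => v ∈ l})
      ⟨G.init % (n + 1), Nat.mod_lt _ (Nat.succ_pos n)⟩ knw ↔ _
    rw [h1, h2, h3, h4]
  · change IsDeterministic (rel (n + 1) fun e => e ∈ es)
      ⟨G.init % (n + 1), Nat.mod_lt _ (Nat.succ_pos n)⟩ ↔ _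
    rw [h1, h4]

theorem theorem5 (knw : Knowledge) :
    (∃ D : GameCode → Prop, ComputablePred D ∧
      ∀ (m n : ℕ) (G : Arena (Fin m) (Fin n)) (F : Fin m → Set (Set (Fin n))) (c : GameCode),
        Encodes c G F →
          (D c ↔ ∃ σ : G.Profile,
            G.IsOIE G.mullerClass Set.univ knw (fun p => G.muller (F p)) σ)) ∧
    (∃ D : GameCode → Prop, ComputablePred D ∧
      ∀ (m n : ℕ) (G : Arena (Fin m) (Fin n)) (F : Fin m → Set (Set (Fin n))) (c : GameCode),
        Encodes c G F →
          (D c ↔ ∃ σ : G.Profile,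
            G.IsOIE G.mullerClass (Set.range mullerWords) knw (fun p => G.muller (F p)) σ)) := by
  refine ⟨?_, CodeHasCertificate knw, computablePred_codeHasCertificate knw, ?_⟩
  · by_cases hk : knw = .pw
    · subst hk
      exact ⟨CodeIsDeterministic, computablePred_codeIsDeterministic, fun m n G F c hc =>
        hc.conditions_iff.2.trans (G.exists_isOIE_pw_univ_iff _ _).symm⟩
    · exact ⟨CodeHasCertificate knw, computablePred_codeHasCertificate knw, fun m n G F c hc =>
        (hc.conditions_iff.1 knw).trans (Arena.exists_isOIE_iff fun h => absurd h hk).symm⟩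
  · exact fun m n G F c hc =>
      (hc.conditions_iff.1 knw).trans (Arena.exists_isOIE_iff fun _ => rfl).symm
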